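/- Ordered abelian groups are considered as structures in the language $\{0,+,-,<\}$. For an elementary extension $M\preccurlyeq N$, $M$ is stably embedded in $N$ if for every $m$ and every $D\subseteq N^m$ definable with parameters from $N$, the trace $D\cap M^m$ is definable in $M$ with parameters from $M$; $M$ is stably embedded if it is stably embedded in all its elementary extensions. An ordered abelian group $G$ is regular if $G/C$ is divisible for every non-trivial convex subgroup $C$ of $G$; it is discrete if it has a least positive element, and dense otherwise. Write $\operatorname{div}(G)$ for its divisible hull. A cut of $G$ is a pair $(L,R)$ of subsets with $L\cup R=G$ and $L<R$; it is definable if $L$ and $R$ are definable in $G$ with parameters, and it is realised in an extension $H$ of $G$ if some $a\in H$ satisfies $L<a<R$. Put $-\infty=(\emptyset,G)$ and $+\infty=(G,\emptyset)$; for $q\in\operatorname{div}(G)$ let $q^+$ be the cut of $G$ with $R=\{x\in G: x>q\}$, and $q^-$ the cut of $G$ with $L=\{x\in G: x<q\}$. Proposition. Let $G$ be a non-trivial regular ordered abelian group. (a) A cut of $G$ is definable if and only if it is $-\infty$, $+\infty$, or of the form $(g/n)^+$ or $(g/n)^-$ with $g\in G$ and $n\in\mathbb{N}_{>0}$. (b)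 Let $H$ be a regular ordered abelian group with $G\preccurlyeq H$. Then $G$ is stably embedded in $H$ if and only if all cuts of $G$ realised in $H$ are definable; equivalently, if and only if every cut of $G$ realised in $H$ is $\pm\infty$ or of the form $(g/n)^{\pm}$ with $g\in G$, $n\in\mathbb{N}_{>0}$. (c) The following are equivalent: 1. $G$ is stably embedded; 2. all cuts of $G$ are definable; 3. either $G$ is dense and archimedean and $\operatorname{div}(G)\cong\mathbb{R}$ as ordered groups, or $G\cong\mathbb{Z}$ as ordered groups. -/

import Mathlib

namespace FirstOrder

/-- Function symbols `0`, `-` (unary) and `+` of the language of ordered abelian groups. -/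
inductive OAGFunc : ℕ → Type
  | zero : OAGFunc 0
  | neg : OAGFunc 1
  | add : OAGFunc 2

/-- The relation symbol `<` of the language of ordered abelian groups. -/
inductive OAGRel : ℕ → Type
  | lt : OAGRel 2

/-- The language `{0, +, -, <}` of ordered abelian groups. -/
def Language.oag : Language.{0, 0} where
  Functions := OAGFunc
  Relations := OAGRel

/-- An ordered abelian group as a structure in the language `{0, +, -, <}`. -/
instance Language.oag.instStructure (G : Type*) [AddCommGroup G] [LinearOrder G] :
    Language.oag.Structure G where
  funMap := fun {_} f =>
    match f with
    | OAGFunc.zero => fun _ => 0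
    | OAGFunc.neg => fun v => -v 0
    | OAGFunc.add => fun v => v 0 + v 1
  RelMap := fun {_} r =>
    match r with
    | OAGRel.lt => fun v => v 0 < v 1

universe u v w w'

/-- `M` is stably embedded in its elementary extension `f : M ↪ₑ[L] N`: the trace on `M` of every
subset of `N ^ m` that is definable with parameters from `N` is definable with parameters from
`M`. -/
def StablyEmbeddedIn {L : Language.{u, v}} {M : Type w} {N : Type w'} [L.Structure M]
    [L.Structure N] (f : M ↪ₑ[L] N) : Prop :=
  ∀ (m : ℕ) (D : Set (Fin m → N)), (Set.univ : Set N).Definable L D →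
    (Set.univ : Set M).Definable L {x : Fin m → M | (fun i => f (x i)) ∈ D}

/-- `M` is stably embedded (in every elementary extension). By Löwenheim-Skolem, extensions
whose carriers lie in the universe `max u v w` suffice. -/
def StablyEmbedded (L : Language.{u, v}) (M : Type w) [L.Structure M] : Prop :=
  ∀ (N : Type (max u v w)) [L.Structure N] (f : M ↪ₑ[L] N), StablyEmbeddedIn f

end FirstOrder

/-- A cut in a totally ordered set `X`: a pair `(left, right)` of subsets of `X` with
`left ∪ right = X` and `left < right`. Either side may be empty. -/
structure OrderCut (X : Type*) [LinearOrder X] where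
  left : Set X
  right : Set X
  union_eq : left ∪ right = Set.univ
  lt : ∀ l ∈ left, ∀ r ∈ right, l < r

namespace OrderCut

/-- A cut of an ordered abelian group is definable if its two sides are definable, with
parameters, in the language of ordered abelian groups. -/
def IsDefinable {G : Type*} [AddCommGroup G] [LinearOrder G] (c : OrderCut G) : Prop :=
  (Set.univ : Set G).Definable₁ FirstOrder.Language.oag c.left ∧
    (Set.univ : Set G).Definable₁ FirstOrder.Language.oag c.right

/-- The cut `c` of `X` is realised in the extension `f : X → Y`: some `a : Y` lies strictly
between its two sides. -/
def IsRealisedIn {X Y : Type*} [LinearOrder X] [LinearOrder Y] (f : X → Y) (c : OrderCut X) :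
    Prop :=
  ∃ a : Y, (∀ l ∈ c.left, f l < a) ∧ ∀ r ∈ c.right, a < f r

/-- The cut `-∞ = (∅, X)`. -/
def IsBot {X : Type*} [LinearOrder X] (c : OrderCut X) : Prop := c.left = ∅

/-- The cut `+∞ = (X, ∅)`. -/
def IsTop {X : Type*} [LinearOrder X] (c : OrderCut X) : Prop := c.right = ∅

/-- `c` is the cut `q⁺` induced on `G` by the element `q` of its divisible hull: the right side
consists of the `x : G` with `q < x`. -/
def IsAbove {G : Type*} [AddCommGroup G] [LinearOrder G] [IsOrderedAddMonoid G]
    (c : OrderCut G) (q : DivisibleHull G) : Prop :=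
  c.right = {x : G | q < (x : DivisibleHull G)}

/-- `c` is the cut `q⁻` induced on `G` by the element `q` of its divisible hull: the left side
consists of the `x : G` with `x < q`. -/
def IsBelow {G : Type*} [AddCommGroup G] [LinearOrder G] [IsOrderedAddMonoid G]
    (c : OrderCut G) (q : DivisibleHull G) : Prop :=
  c.left = {x : G | (x : DivisibleHull G) < q}

/-- `c` is `-∞`, `+∞`, or of the form `(g/n)⁺` or `(g/n)⁻` with `g : G` and `n > 0`. -/
def IsInftyOrRational {G : Type*} [AddCommGroup G] [LinearOrder G] [IsOrderedAddMonoid G]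
    (c : OrderCut G) : Prop :=
  c.IsBot ∨ c.IsTop ∨
    ∃ (g : G) (n : ℕ+), c.IsAbove (DivisibleHull.mk g n) ∨ c.IsBelow (DivisibleHull.mk g n)

end OrderCut

/-- An ordered abelian group is regular if its quotient by every non-trivial convex subgroup is
divisible. -/
def IsRegularOAG (G : Type*) [AddCommGroup G] [LinearOrder G] : Prop :=
  ∀ C : AddSubgroup G, (C : Set G).OrdConnected → C ≠ ⊥ →
    ∀ n : ℕ, 0 < n → ∀ x : G ⧸ C, ∃ y : G ⧸ C, n • y = x

/-- An ordered abelian group is discrete if it has a least positive element. -/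
def IsDiscreteOAG (G : Type*) [AddCommGroup G] [LinearOrder G] : Prop :=
  ∃ a : G, IsLeast {x : G | 0 < x} a

/-- An ordered abelian group is dense if it is not discrete. -/
def IsDenseOAG (G : Type*) [AddCommGroup G] [LinearOrder G] : Prop :=
  ¬ IsDiscreteOAG G

/-!
Regular ordered abelian groups have quantifier elimination, up to parameters, in terms of signs
and divisibility of affine functions `∑ kᵢ xᵢ + g`. Everything follows from this.

The elimination is carried out semantically. The filter `agree ι G` on pairs of tuples is generated
by the conditions that the two tuples give some affine function the same sign, or the same answer
to divisibility by some integer. A set is decided by finitely many affine functions exactly when,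
eventually along this filter, it contains both or none of the members of a pair. That definable sets
have this property (`eventually_mem_iff_of_definable`) is proved by induction on formulas, and the
quantifier step is the back-and-forth property `eventually_extend`: every extension of the first
tuple by one more element is matched by an extension of the second. Two facts enter.
* Congruence conditions can be matched (`eventually_residues`). By the Chinese remainder theorem the
  modulus is a prime power; then the conditions prescribe `p`-adic distances to finitely many
  centres, and a point with given distances exists over one tuple if it does over the other, by
  counting classes modulo `p` (`exists_same_distances`).
* In a regular group every sufficiently long interval meets every residue class
  (`exists_interval_residues`); in the dense case every nonempty open interval does. So order and
  congruence conditions are independent of each other, except for elements very close to one of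
  finitely many given points, and those elements are definable from the point.

Definable cuts: near a cut which is not rational, finitely many affine functions have constant sign,
while every residue class occurs on both sides; so the cut is not definable
(`isInftyOrRational_of_isDefinable`).

Elementary pairs `G ≼ H`: the trace on `G` of `{t > 0}`, for `t` affine over `H`, is the preimage
under an affine function over `G` of one side of a cut realised in `H`, or of `{y : y > g}` with
`g : G`. The trace of a divisibility condition is always definable, since `nH ∩ G = nG`. Hence all
traces are definable as soon as the cuts realised in `H` are.

Absolute version: a cut which is not rational is realised in an ultrapower of `G`; if `G` is
stably embedded there, the cut is the trace of a definable set, hence definable, a contradiction.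
Conversely, elementary extensions of `G` are regular ordered abelian
groups (`exists_orderedAddCommGroup`, `isRegularOAG_of_elementary`). Finally, if all cuts are
rational, then the cut above the convex hull of `ℤ y` shows with regularity that `G` is archimedean,
and an embedding of the divisible hull of a dense `G` into `ℝ` is onto, as a real number is
determined by the cut it induces on the dense subgroup `G`.
-/

namespace RegularOAG

open Filter FirstOrder

universe u

/-! ### Divisibility in abelian groups -/

/-- The subgroup `nG` of the elements of `G` divisible by `n`. -/
def multiples (G : Type*) [AddCommGroup G] (n : ℤ) : AddSubgroup G :=
  (zsmulAddGroupHom n).range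

section Divisibility

variable {G : Type*} [AddCommGroup G]

theorem mem_multiples {n : ℤ} {g : G} : g ∈ multiples G n ↔ ∃ u, n • u = g := Iff.rfl

theorem zsmul_mem_multiples (n : ℤ) (g : G) : n • g ∈ multiples G n := ⟨g, rfl⟩

@[simp] theorem multiples_one : multiples G 1 = ⊤ :=
  eq_top_iff.2 fun g _ => ⟨g, one_zsmul g⟩

theorem multiples_mono {m n : ℤ} (h : m ∣ n) : multiples G n ≤ multiples G m := by
  rintro _ ⟨u, rfl⟩
  obtain ⟨k, rfl⟩ := h
  exact ⟨k • u, by simp [mul_zsmul]⟩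

theorem multiples_natAbs (m : ℤ) : multiples G m.natAbs = multiples G m :=
  le_antisymm (multiples_mono (Int.dvd_natAbs_self)) (multiples_mono Int.natAbs_dvd_self)

theorem mem_multiples_zero_iff [LinearOrder G] {g : G} :
    g ∈ multiples G 0 ↔ ¬ 0 < g ∧ ¬ g < 0 := by
  rw [not_lt, not_lt, ← le_antisymm_iff]
  exact ⟨fun ⟨u, hu⟩ => by simpa using hu.symm, fun h => h ▸ zero_mem _⟩

theorem zsmul_mem_multiples_mul [IsAddTorsionFree G] {k : ℤ} (hk : k ≠ 0) {n : ℤ} {g : G} :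
    k • g ∈ multiples G (k * n) ↔ g ∈ multiples G n := by
  constructor
  · rintro ⟨u, hu⟩
    refine ⟨u, zsmul_right_injective hk ?_⟩
    simpa [mul_zsmul] using hu
  · rintro ⟨u, rfl⟩
    exact ⟨u, by simp [mul_zsmul]⟩

theorem zsmul_add_mem_congr {m : ℤ} {y w : G} (h : y - w ∈ multiples G m) (k : ℤ) (s : G) :
    k • y + s ∈ multiples G m ↔ k • w + s ∈ multiples G m := by
  have h1 : k • y + s = k • (y - w) + (k • w + s) := by rw [zsmul_sub]; abel
  rw [h1]
  exact AddSubgroup.add_mem_cancel_left _ (AddSubgroup.zsmul_mem _ h k)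

theorem zsmul_mem_multiples_iff_of_isCoprime {l n : ℤ} (h : IsCoprime l n) {g : G} :
    l • g ∈ multiples G n ↔ g ∈ multiples G n := by
  refine ⟨fun hg => ?_, fun hg => AddSubgroup.zsmul_mem _ hg l⟩
  obtain ⟨a, b, hab⟩ := h
  have : g = a • (l • g) + n • (b • g) := by
    rw [← mul_zsmul, ← mul_zsmul, mul_comm n b, ← add_zsmul, hab, one_zsmul]
  rw [this]
  exact add_mem (AddSubgroup.zsmul_mem _ hg a) (zsmul_mem_multiples n _)

end Divisibility

/-- If two finite families of points have the same pattern of coincidences and the first one does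
not exhaust its type, neither does the second. -/
theorem exists_notMem_of_same_coincidences {ι V : Type*} [Finite ι] (c c' : ι → V)
    (h : ∀ i j, c i = c j ↔ c' i = c' j) (hc : ∃ v, ∀ i, v ≠ c i) : ∃ w, ∀ i, w ≠ c' i := by
  by_contra! hw
  choose s hs using hw
  have : Finite V := Finite.of_injective s fun a b hab => by rw [hs a, hs b, hab]
  have hinj : Function.Injective fun v => c (s v) := fun a b hab => by
    rw [hs a, hs b]
    exact (h _ _).1 hab
  obtain ⟨v, hv⟩ := hc
  obtain ⟨a, ha⟩ := Finite.injective_iff_surjective.1 hinj v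
  exact hv _ ha.symm

/-- For the chain of subgroups `p ^ f G`, a point `y` can be moved along with a finite family of
centres: if the family `c'` has the same mutual `p`-adic distances as `c`, some `w` has the same
distances to `c'` as `y` has to `c`. -/
theorem exists_same_distances {G : Type*} [AddCommGroup G] [IsAddTorsionFree G] {p : ℤ}
    (hp : p ≠ 0) (E : ℕ) :
    ∀ {ι : Type u} [Finite ι] (c c' : ι → G),
      (∀ i j, ∀ f ≤ E, c i - c j ∈ multiples G (p ^ f) ↔ c' i - c' j ∈ multiples G (p ^ f)) →
      ∀ y : G, ∃ w : G, ∀ i, ∀ f ≤ E,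
        y - c i ∈ multiples G (p ^ f) ↔ w - c' i ∈ multiples G (p ^ f) := by
  induction E with
  | zero =>
    intro ι _ c c' _ y
    exact ⟨0, fun i f hf => by simp [Nat.le_zero.1 hf]⟩
  | succ E ih =>
    intro ι _ c c' h y
    have h1 : ∀ i j, c i - c j ∈ multiples G p ↔ c' i - c' j ∈ multiples G p := fun i j => by
      simpa using h i j 1 (by omega)
    have hle : ∀ f : ℕ, multiples G (p ^ (f + 1)) ≤ multiples G p := fun f =>
      multiples_mono (Dvd.intro_left (p ^ f) (pow_succ p f).symm)
    by_cases hy : ∃ i, y - c i ∈ multiples G p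
    · -- Inside the ball of radius `p` around `c i₀`, rescale by `p`.
      obtain ⟨i₀, y₁, hy₁⟩ := hy
      replace hy₁ : p • y₁ = y - c i₀ := hy₁
      have hd : ∀ j : {j // c j - c i₀ ∈ multiples G p}, ∃ u, p • u = c j - c i₀ := fun j => j.2
      have hd' : ∀ j : {j // c j - c i₀ ∈ multiples G p}, ∃ u, p • u = c' j - c' i₀ := fun j =>
        (h1 _ _).1 j.2
      choose d hd using hd
      choose d' hd' using hd'
      have key : ∀ (f : ℕ) (g : G),
          p • g ∈ multiples G (p ^ (f + 1)) ↔ g ∈ multiples G (p ^ f) := fun f g => by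
        rw [pow_succ', zsmul_mem_multiples_mul hp]
      obtain ⟨w₁, hw₁⟩ := ih d d' (fun i j f hf => by
        rw [← key, ← key f (d' i - d' j), zsmul_sub, zsmul_sub, hd, hd, hd', hd']
        simpa using h i j (f + 1) (by omega)) y₁
      refine ⟨c' i₀ + p • w₁, fun j f hf => ?_⟩
      rcases f with _ | f
      · simp
      by_cases hj : c j - c i₀ ∈ multiples G p
      · have e1 : y - c j = p • (y₁ - d ⟨j, hj⟩) := by
          rw [zsmul_sub, hd, hy₁]; abel
        have e2 : c' i₀ + p • w₁ - c' j = p • (w₁ - d' ⟨j, hj⟩) := by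
          rw [zsmul_sub, hd']; abel
        rw [e1, e2, key, key]
        exact hw₁ _ f (by omega)
      · have hj' : c' j - c' i₀ ∉ multiples G p := fun h => hj ((h1 _ _).2 h)
        refine iff_of_false (fun hm => hj ?_) (fun hm => hj' ?_)
        · have := sub_mem (show y - c i₀ ∈ multiples G p from ⟨y₁, hy₁⟩) (hle f hm)
          simpa using this
        · have := sub_mem (zsmul_mem_multiples p w₁) (hle f hm)
          rwa [show p • w₁ - (c' i₀ + p • w₁ - c' j) = c' j - c' i₀ by abel] at this
    · -- No centre is close to `y`: it suffices to avoid all classes of centres modulo `p`.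
      push Not at hy
      have hq : ∀ a b : G, ((a : G ⧸ multiples G p) = b ↔ a - b ∈ multiples G p) := fun a b => by
        rw [eq_comm, QuotientAddGroup.eq, neg_add_eq_sub]
      obtain ⟨w, hw⟩ := exists_notMem_of_same_coincidences
        (fun i => (c i : G ⧸ multiples G p)) (fun i => (c' i : G ⧸ multiples G p))
        (fun i j => by rw [hq, hq]; exact h1 i j) ⟨(y : G ⧸ multiples G p), fun i hi =>
          hy i ((hq _ _).1 hi)⟩
      obtain ⟨w, rfl⟩ := QuotientAddGroup.mk_surjective w
      refine ⟨w, fun i f hf => ?_⟩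
      rcases f with _ | f
      · simp
      · exact iff_of_false (fun hm => hy i (hle f hm)) fun hm => hw i ((hq _ _).2 (hle f hm))

/-! ### Affine functions and the agreement filter -/

/-- The group of functions `(ι → G) → G` of the form `∑ kᵢ xᵢ + g` with integers `kᵢ`, almost all
of them zero, and `g : G`. -/
def affine (ι G : Type*) [AddCommGroup G] : AddSubgroup ((ι → G) → G) :=
  AddSubgroup.closure (Set.range (fun i x => x i) ∪ Set.range (fun g _ => g))

/-- The filter on pairs of tuples generated, for affine `t` and `m : ℤ`, by the conditions that
`t x > 0` holds for both tuples or for none, and likewise `m ∣ t x`. A set of tuples is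
quantifier-free definable with divisibility predicates exactly when eventually both or none of
the tuples of a pair belong to it. -/
def agree (ι G : Type*) [AddCommGroup G] [LinearOrder G] : Filter ((ι → G) × (ι → G)) :=
  ⨅ a : affine ι G × ℤ, 𝓟 {p | (0 < a.1.1 p.1 ↔ 0 < a.1.1 p.2) ∧
    (a.1.1 p.1 ∈ multiples G a.2 ↔ a.1.1 p.2 ∈ multiples G a.2)}

section Affine

variable {ι G : Type*} [AddCommGroup G]

theorem coord_mem_affine (i : ι) : (fun x : ι → G => x i) ∈ affine ι G :=
  AddSubgroup.subset_closure (Or.inl ⟨i, rfl⟩)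

theorem const_mem_affine (g : G) : (fun _ : ι → G => g) ∈ affine ι G :=
  AddSubgroup.subset_closure (Or.inr ⟨g, rfl⟩)

/-- Induction principle for affine functions. -/
theorem affine_induction {P : ((ι → G) → G) → Prop} (coord : ∀ i, P fun x => x i)
    (const : ∀ g, P fun _ => g) (add : ∀ s t, P s → P t → P (s + t)) (neg : ∀ s, P s → P (-s))
    {t : (ι → G) → G} (ht : t ∈ affine ι G) : P t := by
  induction ht using AddSubgroup.closure_induction with
  | mem x hx =>
    rcases hx with ⟨i, rfl⟩ | ⟨g, rfl⟩
    exacts [coord i, const g]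
  | zero => exact const 0
  | add s t _ _ hs ht => exact add s t hs ht
  | neg s _ hs => exact neg s hs

variable [LinearOrder G]

theorem eventually_pos_iff {t : (ι → G) → G} (ht : t ∈ affine ι G) :
    ∀ᶠ p in agree ι G, (0 < t p.1 ↔ 0 < t p.2) :=
  mem_of_superset (mem_iInf_of_mem ((⟨t, ht⟩, 0) : affine ι G × ℤ) (mem_principal_self _))
    fun _ hp => hp.1

theorem eventually_mem_multiples_iff {t : (ι → G) → G} (ht : t ∈ affine ι G) (m : ℤ) :
    ∀ᶠ p in agree ι G, (t p.1 ∈ multiples G m ↔ t p.2 ∈ multiples G m) :=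
  mem_of_superset (mem_iInf_of_mem ((⟨t, ht⟩, m) : affine ι G × ℤ) (mem_principal_self _))
    fun _ hp => hp.2

theorem eventually_lt_iff [IsOrderedAddMonoid G] {s t : (ι → G) → G} (hs : s ∈ affine ι G)
    (ht : t ∈ affine ι G) : ∀ᶠ p in agree ι G, (s p.1 < t p.1 ↔ s p.2 < t p.2) := by
  filter_upwards [eventually_pos_iff (sub_mem ht hs)] with p hp
  simpa using hp

/-- Membership in the agreement filter is witnessed by finitely many affine functions. -/
theorem exists_finite_of_mem_agree {U : Set ((ι → G) × (ι → G))} (hU : U ∈ agree ι G) :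
    ∃ S : Set (affine ι G × ℤ), S.Finite ∧ ∀ p : (ι → G) × (ι → G),
      (∀ a ∈ S, (0 < a.1.1 p.1 ↔ 0 < a.1.1 p.2) ∧
        (a.1.1 p.1 ∈ multiples G a.2 ↔ a.1.1 p.2 ∈ multiples G a.2)) → p ∈ U := by
  obtain ⟨S, hS, hSU⟩ := (hasBasis_iInf_principal_finite _).mem_iff.1 hU
  exact ⟨S, hS, fun p hp => hSU (Set.mem_iInter₂.2 hp)⟩

end Affine

/-! ### Moving residues along -/

section Residues

/-- Modulo `p ^ E` every integer is, up to a unit, a power of `p`. -/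
theorem exists_unit_mul_eq_pow {p : ℕ} (hp : p.Prime) (E : ℕ) (k : ℤ) :
    ∃ (a : ℕ) (l : ℤ), (p : ℤ) ^ E ∣ l * k - p ^ a ∧ IsCoprime l ((p : ℤ) ^ E) := by
  have hp' : Prime (p : ℤ) := Nat.prime_iff_prime_int.1 hp
  by_cases hk : k = 0
  · exact ⟨E, 1, by simp [hk], isCoprime_one_left⟩
  · have hfin : FiniteMultiplicity (p : ℤ) k := by
      rw [Int.finiteMultiplicity_iff]
      exact ⟨by simpa using hp.ne_one, hk⟩
    obtain ⟨c, hc, hnd⟩ := hfin.exists_eq_pow_mul_and_not_dvd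
    have hcop : IsCoprime c ((p : ℤ) ^ E) :=
      (((hp'.irreducible.coprime_iff_not_dvd).2 hnd).symm).pow_right
    obtain ⟨l, q, hlq⟩ := hcop
    refine ⟨multiplicity (p : ℤ) k, l, ⟨- q * p ^ multiplicity (p : ℤ) k, ?_⟩, ?_⟩
    · conv_lhs => enter [1, 2]; rw [hc]
      linear_combination (p : ℤ) ^ multiplicity (p : ℤ) k * hlq
    · exact ⟨c, q, by linear_combination hlq⟩

variable {ι G : Type*} [AddCommGroup G] [LinearOrder G] [IsOrderedAddMonoid G]

/-- Conditions modulo powers of `p` on `p ^ a y + s`: these are conditions on the `p`-adic distances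
of `y` to centres, and the distances between the centres are decided by affine functions. -/
theorem eventually_residues_pow_monic {κ : Type*} [Finite κ] {p : ℕ} (hp : p.Prime) (E : ℕ)
    (a : κ → ℕ) (s : κ → (ι → G) → G) (hs : ∀ i, s i ∈ affine ι G) :
    ∀ᶠ x in agree ι G, ∀ y : G, ∃ w : G, ∀ i, ∀ e ≤ E,
      ((p : ℤ) ^ a i) • y + s i x.1 ∈ multiples G ((p : ℤ) ^ e) ↔
        ((p : ℤ) ^ a i) • w + s i x.2 ∈ multiples G ((p : ℤ) ^ e) := by
  have hp0 : (p : ℤ) ≠ 0 := by exact_mod_cast hp.ne_zero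
  have h1 : ∀ᶠ x in agree ι G, ∀ i, ∀ e < a i + E + 1,
      (s i x.1 ∈ multiples G ((p : ℤ) ^ e) ↔ s i x.2 ∈ multiples G ((p : ℤ) ^ e)) :=
    eventually_all.2 fun i => (eventually_all_finite (Set.finite_lt_nat _)).2 fun e _ =>
      eventually_mem_multiples_iff (hs i) _
  have h2 : ∀ᶠ x in agree ι G, ∀ i j, ∀ f < E + 1,
      (((p : ℤ) ^ a i • s j - (p : ℤ) ^ a j • s i) x.1 ∈ multiples G ((p : ℤ) ^ (a i + a j + f)) ↔
      ((p : ℤ) ^ a i • s j - (p : ℤ) ^ a j • s i) x.2 ∈ multiples G ((p : ℤ) ^ (a i + a j + f))) :=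
    eventually_all.2 fun i => eventually_all.2 fun j =>
      (eventually_all_finite (Set.finite_lt_nat _)).2 fun e _ =>
        eventually_mem_multiples_iff
          (sub_mem (AddSubgroup.zsmul_mem _ (hs j) _) (AddSubgroup.zsmul_mem _ (hs i) _)) _
  filter_upwards [h1, h2] with x h1 h2 y
  -- The condition on `i` says how close `y` is to the centre `-s i x / p ^ a i`, if that exists.
  have hc : ∀ i : {i // s i x.1 ∈ multiples G ((p : ℤ) ^ a i)},
      ∃ u, ((p : ℤ) ^ a i.1) • u = - s i x.1 := fun i => neg_mem i.2
  have hc' : ∀ i : {i // s i x.1 ∈ multiples G ((p : ℤ) ^ a i)},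
      ∃ u, ((p : ℤ) ^ a i.1) • u = - s i x.2 := fun i =>
    neg_mem ((h1 i (a i) (by omega)).1 i.2)
  choose c hc using hc
  choose c' hc' using hc'
  obtain ⟨w, hw⟩ := exists_same_distances hp0 E c c' (fun i j f hf => by
    have hne : (p : ℤ) ^ (a i + a j) ≠ 0 := pow_ne_zero _ hp0
    rw [← zsmul_mem_multiples_mul hne, ← zsmul_mem_multiples_mul hne (g := c' i - c' j),
      ← pow_add]
    have e : ∀ (d : {i // s i x.1 ∈ multiples G ((p : ℤ) ^ a i)} → G) (z : ι → G),
        (∀ i, ((p : ℤ) ^ a i.1) • d i = - s i z) → (p : ℤ) ^ (a i + a j) • (d i - d j) =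
          ((p : ℤ) ^ a i • s j - (p : ℤ) ^ a j • s i) z := fun d z hd => by
      rw [zsmul_sub, pow_add, mul_comm, mul_zsmul, hd, mul_comm, mul_zsmul, hd]
      simp only [Pi.sub_apply, Pi.smul_apply, zsmul_neg]
      abel
    rw [e c x.1 hc, e c' x.2 hc']
    exact h2 i j f (by omega)) y
  refine ⟨w, fun i e he => ?_⟩
  rcases le_or_gt e (a i) with hea | hea
  · have h3 : ∀ z : G, (p : ℤ) ^ a i • z ∈ multiples G ((p : ℤ) ^ e) := fun z =>
      multiples_mono (pow_dvd_pow _ hea) (zsmul_mem_multiples _ z)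
    rw [AddSubgroup.add_mem_cancel_left _ (h3 _), AddSubgroup.add_mem_cancel_left _ (h3 _)]
    exact h1 i e (by omega)
  · have hle := multiples_mono (G := G) (pow_dvd_pow (p : ℤ) hea.le)
    by_cases hi : s i x.1 ∈ multiples G ((p : ℤ) ^ a i)
    · obtain ⟨f, rfl⟩ := Nat.exists_eq_add_of_lt hea
      have hne : (p : ℤ) ^ a i ≠ 0 := pow_ne_zero _ hp0
      have e1 : ((p : ℤ) ^ a i) • y + s i x.1 = ((p : ℤ) ^ a i) • (y - c ⟨i, hi⟩) := by
        rw [zsmul_sub, show (p : ℤ) ^ a i • c ⟨i, hi⟩ = _ from hc ⟨i, hi⟩, sub_neg_eq_add]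
      have e2 : ((p : ℤ) ^ a i) • w + s i x.2 = ((p : ℤ) ^ a i) • (w - c' ⟨i, hi⟩) := by
        rw [zsmul_sub, show (p : ℤ) ^ a i • c' ⟨i, hi⟩ = _ from hc' ⟨i, hi⟩, sub_neg_eq_add]
      rw [e1, e2, add_assoc, pow_add, zsmul_mem_multiples_mul hne, zsmul_mem_multiples_mul hne]
      exact hw ⟨i, hi⟩ _ (by omega)
    · refine iff_of_false (fun hm => hi ?_) fun hm => hi ((h1 i (a i) (by omega)).2 ?_)
      · exact (AddSubgroup.add_mem_cancel_left _ (zsmul_mem_multiples _ y)).1 (hle hm)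
      · exact (AddSubgroup.add_mem_cancel_left _ (zsmul_mem_multiples _ w)).1 (hle hm)

theorem eventually_residues_pow {κ : Type*} [Finite κ] {p : ℕ} (hp : p.Prime) (E : ℕ)
    (k : κ → ℤ) (s : κ → (ι → G) → G) (hs : ∀ i, s i ∈ affine ι G) :
    ∀ᶠ x in agree ι G, ∀ y : G, ∃ w : G, ∀ i, ∀ e ≤ E,
      k i • y + s i x.1 ∈ multiples G ((p : ℤ) ^ e) ↔
        k i • w + s i x.2 ∈ multiples G ((p : ℤ) ^ e) := by
  choose a l hal hl using fun i => exists_unit_mul_eq_pow hp E (k i)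
  have key : ∀ i, ∀ e ≤ E, ∀ y t : G, k i • y + t ∈ multiples G ((p : ℤ) ^ e) ↔
      ((p : ℤ) ^ a i) • y + l i • t ∈ multiples G ((p : ℤ) ^ e) := fun i e he y t => by
    have hdvd : (p : ℤ) ^ e ∣ (p : ℤ) ^ E := pow_dvd_pow _ he
    rw [← zsmul_mem_multiples_iff_of_isCoprime ((hl i).of_isCoprime_of_dvd_right hdvd)]
    have e1 : l i • (k i • y + t) =
        (l i * k i - (p : ℤ) ^ a i) • y + ((p : ℤ) ^ a i • y + l i • t) := by
      rw [zsmul_add, ← mul_zsmul, sub_zsmul, mul_comm]; abel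
    rw [e1, AddSubgroup.add_mem_cancel_left]
    exact multiples_mono (hdvd.trans (hal i)) (zsmul_mem_multiples _ y)
  filter_upwards [eventually_residues_pow_monic hp E a (fun i => l i • s i) fun i =>
    AddSubgroup.zsmul_mem _ (hs i) _] with x hx y
  obtain ⟨w, hw⟩ := hx y
  refine ⟨w, fun i e he => ?_⟩
  rw [key i e he, key i e he]
  exact hw i e he

/-- Divisibility conditions on one more variable can be moved along: eventually, for every `y`
there is `w` satisfying over `x.2` the same congruences modulo divisors of `M` as `y` over
`x.1`. -/
theorem eventually_residues {κ : Type*} [Finite κ] {M : ℕ} (hM : M ≠ 0)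
    (k : κ → ℤ) (s : κ → (ι → G) → G) (hs : ∀ i, s i ∈ affine ι G) :
    ∀ᶠ x in agree ι G, ∀ y : G, ∃ w : G, ∀ i, ∀ d : ℕ, d ∣ M →
      (k i • y + s i x.1 ∈ multiples G d ↔ k i • w + s i x.2 ∈ multiples G d) := by
  induction M using Nat.recOnPosPrimePosCoprime with
  | zero => exact absurd rfl hM
  | one =>
    refine .of_forall fun x y => ⟨0, fun i d hd => ?_⟩
    rw [Nat.dvd_one.1 hd]
    simp
  | prime_pow p n hp _ =>
    filter_upwards [eventually_residues_pow hp n k s hs] with x hx y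
    obtain ⟨w, hw⟩ := hx y
    refine ⟨w, fun i d hd => ?_⟩
    obtain ⟨e, he, rfl⟩ := (Nat.dvd_prime_pow hp).1 hd
    simpa using hw i e he
  | coprime a b ha hb hab iha ihb =>
    filter_upwards [iha (by omega), ihb (by omega)] with x hxa hxb y
    obtain ⟨wa, hwa⟩ := hxa y
    obtain ⟨wb, hwb⟩ := hxb y
    obtain ⟨u, v, huv⟩ := Nat.isCoprime_iff_coprime.2 hab
    -- `w ≡ wa` modulo `a` and `w ≡ wb` modulo `b`.
    refine ⟨(v * b) • wa + (u * a) • wb, fun i d hd => ?_⟩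
    obtain ⟨d₁, d₂, h₁, h₂, rfl⟩ := (Nat.dvd_mul).1 hd
    have hw₁ : (v * b) • wa + (u * a) • wb - wa ∈ multiples G d₁ := by
      have : (v * b) • wa + (u * a) • wb - wa = (a : ℤ) • (u • (wb - wa)) := by
        linear_combination (norm := module) huv • wa
      rw [this]
      exact multiples_mono (Int.natCast_dvd_natCast.2 h₁) (zsmul_mem_multiples _ _)
    have hw₂ : (v * b) • wa + (u * a) • wb - wb ∈ multiples G d₂ := by
      have : (v * b) • wa + (u * a) • wb - wb = (b : ℤ) • (v • (wa - wb)) := by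
        linear_combination (norm := module) huv • wb
      rw [this]
      exact multiples_mono (Int.natCast_dvd_natCast.2 h₂) (zsmul_mem_multiples _ _)
    have hcop : IsCoprime (d₁ : ℤ) d₂ :=
      Nat.isCoprime_iff_coprime.2 (Nat.Coprime.of_dvd h₁ h₂ hab)
    have hsplit : ∀ g : G, g ∈ multiples G ((d₁ * d₂ : ℕ) : ℤ) ↔
        g ∈ multiples G d₁ ∧ g ∈ multiples G d₂ := fun g => by
      refine ⟨fun hg => ⟨multiples_mono (by simp) hg, multiples_mono (by simp) hg⟩, ?_⟩
      rintro ⟨⟨g₁, hg₁⟩, hg₂⟩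
      replace hg₁ : (d₁ : ℤ) • g₁ = g := hg₁
      rw [← hg₁, zsmul_mem_multiples_iff_of_isCoprime hcop] at hg₂
      obtain ⟨g₂, hg₂⟩ := hg₂
      replace hg₂ : (d₂ : ℤ) • g₂ = g₁ := hg₂
      exact ⟨g₂, by simp [← hg₁, ← hg₂, mul_zsmul]⟩
    rw [hsplit, hsplit, hwa i d₁ h₁, hwb i d₂ h₂, zsmul_add_mem_congr hw₁,
      zsmul_add_mem_congr hw₂]

end Residues

/-! ### Regular groups -/

section Regular

variable {G : Type*} [AddCommGroup G] [LinearOrder G] [IsOrderedAddMonoid G]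

/-- The convex subgroup generated by `e`. -/
def convexSpan (e : G) : AddSubgroup G where
  carrier := {x | ∃ k : ℕ, |x| ≤ k • |e|}
  zero_mem' := ⟨0, by simp⟩
  add_mem' := by
    rintro x y ⟨k, hk⟩ ⟨l, hl⟩
    exact ⟨k + l, (abs_add_le x y).trans (by rw [add_nsmul]; exact add_le_add hk hl)⟩
  neg_mem' := by
    rintro x ⟨k, hk⟩
    exact ⟨k, by rwa [abs_neg]⟩

theorem ordConnected_convexSpan (e : G) : (convexSpan e : Set G).OrdConnected := by
  refine ⟨fun x hx y hy z hz => ?_⟩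
  obtain ⟨k, hk⟩ := hx
  obtain ⟨l, hl⟩ := hy
  refine ⟨k + l, ?_⟩
  have hk0 : 0 ≤ k • |e| := nsmul_nonneg (abs_nonneg e) k
  have hl0 : 0 ≤ l • |e| := nsmul_nonneg (abs_nonneg e) l
  rw [add_nsmul, abs_le]
  rw [abs_le] at hk hl
  constructor
  · calc -(k • |e| + l • |e|) ≤ -(k • |e|) := by simpa using hl0
      _ ≤ z := hk.1.trans hz.1
  · calc z ≤ l • |e| := hz.2.trans hl.2
      _ ≤ _ := by simpa using hk0

theorem self_mem_convexSpan (e : G) : e ∈ convexSpan e := ⟨1, by simp⟩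

theorem convexSpan_ne_bot {e : G} (he : e ≠ 0) : convexSpan e ≠ ⊥ := fun h =>
  he ((AddSubgroup.mem_bot).1 (h ▸ self_mem_convexSpan e))

/-- Regularity in first-order form: every interval `[a, a + n e)` with `e > 0` contains a multiple
of `n`. -/
theorem exists_zsmul_mem_Ico (hG : IsRegularOAG G) {n : ℕ} (hn : 0 < n) {e : G} (he : 0 < e)
    (a : G) : ∃ y : G, a ≤ (n : ℤ) • y ∧ (n : ℤ) • y < a + (n : ℤ) • e := by
  obtain ⟨y, hy⟩ := hG (convexSpan e) (ordConnected_convexSpan e) (convexSpan_ne_bot he.ne') n hn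
    (a : G ⧸ convexSpan e)
  obtain ⟨y, rfl⟩ := QuotientAddGroup.mk_surjective y
  have hy' : -(n • y) + a ∈ convexSpan e := QuotientAddGroup.eq.1 hy
  obtain ⟨k, hk⟩ := hy'
  rw [abs_of_pos he, abs_le] at hk
  have hne : e ≤ (n : ℤ) • e := by
    rw [natCast_zsmul]; exact le_self_nsmul he.le hn.ne'
  have hne0 : 0 < (n : ℤ) • e := he.trans_le hne
  have hkk : k • e ≤ (k : ℤ) • ((n : ℤ) • e) := by
    rw [natCast_zsmul]; exact nsmul_le_nsmul_right hne k
  -- The least multiple of `n e` above `a - n y` corrects `y`.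
  obtain ⟨j, hj, hmin⟩ := Int.exists_least_of_bdd (P := fun j : ℤ =>
      -(n • y) + a ≤ j • ((n : ℤ) • e)) ⟨-k, fun j hj => by
        by_contra! hlt
        have h1 : j • ((n : ℤ) • e) < (-k : ℤ) • ((n : ℤ) • e) :=
          (zsmul_lt_zsmul_iff_left hne0).2 hlt
        rw [neg_zsmul] at h1
        exact absurd ((hk.1.trans hj).trans_lt h1) (not_lt.2 (neg_le_neg hkk))⟩
      ⟨k, hk.2.trans hkk⟩
  have hj' : (j - 1) • ((n : ℤ) • e) < -(n • y) + a := by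
    by_contra! h
    have := hmin _ h
    omega
  have e1 : (n : ℤ) • (y + j • e) = n • y + j • ((n : ℤ) • e) := by
    rw [zsmul_add, natCast_zsmul, zsmul_comm]
  refine ⟨y + j • e, ?_, ?_⟩
  · rw [e1]
    exact neg_add_le_iff_le_add.1 hj
  · rw [e1]
    rw [sub_zsmul, one_zsmul, lt_neg_add_iff_add_lt] at hj'
    rwa [← sub_lt_iff_lt_add, add_sub_assoc, sub_eq_add_neg]

omit [IsOrderedAddMonoid G] in
theorem exists_lt_of_isDenseOAG (hd : IsDenseOAG G) {d : G} (h : 0 < d) : ∃ e, 0 < e ∧ e < d := by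
  by_contra! hne
  exact hd ⟨d, h, fun e he => hne e he⟩

theorem exists_nsmul_le_of_isDenseOAG (hd : IsDenseOAG G) (n : ℕ) {d : G} (h : 0 < d) :
    ∃ e, 0 < e ∧ n • e ≤ d := by
  have half : ∀ d : G, 0 < d → ∃ e, 0 < e ∧ e + e ≤ d := fun d h => by
    obtain ⟨e, he, hed⟩ := exists_lt_of_isDenseOAG hd h
    rcases le_total e (d - e) with h1 | h1
    · exact ⟨e, he, by rwa [← le_sub_iff_add_le]⟩
    · exact ⟨d - e, sub_pos.2 hed, by
        calc d - e + (d - e) ≤ d - e + e := by gcongr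
          _ = d := by abel⟩
  induction n generalizing d with
  | zero => exact ⟨d, h, by simpa using h.le⟩
  | succ n ih =>
    obtain ⟨e, he, hed⟩ := half d h
    obtain ⟨e', he', hed'⟩ := ih he
    refine ⟨min e e', lt_min he he', ?_⟩
    calc (n + 1) • min e e' = n • min e e' + min e e' := succ_nsmul _ _
      _ ≤ n • e' + e := add_le_add (nsmul_le_nsmul_right (min_le_right _ _) n) (min_le_left _ _)
      _ ≤ e + e := by gcongr
      _ ≤ d := hed

/-- In a regular group there are a bound `j₀` and a finite set `J` such that open intervals of
length greater than `j₀` meet all classes modulo `M`, while elements above `a` within distance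
`j₀` lie in `a + J`. In a dense group `j₀ = 0`; in a discrete one `J` consists of the first
multiples of the least positive element. -/
theorem exists_interval_residues (hG : IsRegularOAG G) {M : ℕ} (hM : 0 < M) :
    ∃ (J : Finset G) (j₀ : G),
      (∀ a b w : G, a + j₀ < b → ∃ z, a < z ∧ z < b ∧ z - w ∈ multiples G M) ∧
      ∀ a z : G, a < z → (∀ j ∈ J, z ≠ a + j) → a + j₀ < z := by
  have key : ∀ a e w : G, 0 < e → ∃ z, a < z ∧ z < a + (M + 1) • e ∧ z - w ∈ multiples G M :=
      fun a e w he => by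
    obtain ⟨y, hy₁, hy₂⟩ := exists_zsmul_mem_Ico hG hM he (a + e - w)
    refine ⟨w + (M : ℤ) • y, ?_, ?_, ?_⟩
    · calc a < a + e := by simpa using he
        _ ≤ w + (M : ℤ) • y := by rwa [← sub_le_iff_le_add']
    · calc w + (M : ℤ) • y < w + (a + e - w + (M : ℤ) • e) := by gcongr
        _ = a + (M + 1) • e := by rw [natCast_zsmul, succ_nsmul]; abel
    · rw [add_sub_cancel_left]
      exact zsmul_mem_multiples _ y
  by_cases hd : IsDiscreteOAG G
  · obtain ⟨u, hu, hmin⟩ := hd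
    refine ⟨(Finset.range (M + 2)).image (fun j => j • u), (M + 1) • u, fun a b w hab => ?_,
      fun a z haz hz => ?_⟩
    · obtain ⟨z, h₁, h₂, h₃⟩ := key a u w hu
      exact ⟨z, h₁, h₂.trans hab, h₃⟩
    · have : ∀ j < M + 2, a + j • u < z := fun j => by
        induction j with
        | zero => intro _; simpa using haz
        | succ j ih =>
          intro hj
          have h1 : u ≤ z - (a + j • u) := hmin (sub_pos.2 (ih (by omega)))
          refine lt_of_le_of_ne ?_ (hz _ (Finset.mem_image_of_mem _ (Finset.mem_range.2 hj))).symm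
          rw [succ_nsmul, ← add_assoc]
          rwa [le_sub_iff_add_le'] at h1
      exact this (M + 1) (by omega)
  · refine ⟨∅, 0, fun a b w hab => ?_, fun a z haz _ => by simpa using haz⟩
    rw [add_zero] at hab
    obtain ⟨e, he, hle⟩ := exists_nsmul_le_of_isDenseOAG hd (M + 1) (sub_pos.2 hab)
    obtain ⟨z, h₁, h₂, h₃⟩ := key a e w he
    refine ⟨z, h₁, h₂.trans_le ?_, h₃⟩
    rwa [← le_sub_iff_add_le']

end Regular

/-! ### Extending tuples -/

section Extend

variable {ι G : Type*} [AddCommGroup G] [LinearOrder G] [IsOrderedAddMonoid G]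

/-- The sign of `k y + s` is determined by the position of `k q y` relative to `-q s`. -/
theorem sign_congr {k q : ℤ} (hkq : 0 < k * q) {y y' s s' : G}
    (h₁ : (-q) • s < (k * q) • y ↔ (-q) • s' < (k * q) • y')
    (h₂ : (k * q) • y < (-q) • s ↔ (k * q) • y' < (-q) • s') :
    (0 < k • y + s ↔ 0 < k • y' + s') ∧ (k • y + s < 0 ↔ k • y' + s' < 0) := by
  have e : ∀ y s : G, (k * q) • y - (-q) • s = q • (k • y + s) := fun y s => by module
  rw [← sub_pos, e, ← sub_pos (a := (k * q) • y'), e] at h₁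
  rw [← sub_neg, e, ← sub_neg (a := (k * q) • y'), e] at h₂
  rcases lt_trichotomy q 0 with hq | rfl | hq
  · rw [smul_pos_iff_of_neg_left hq, smul_pos_iff_of_neg_left hq] at h₁
    rw [smul_neg_iff_of_neg_left hq, smul_neg_iff_of_neg_left hq] at h₂
    exact ⟨h₂, h₁⟩
  · simp at hkq
  · rw [smul_pos_iff_of_pos_left hq, smul_pos_iff_of_pos_left hq] at h₁
    rw [smul_neg_iff_of_pos_left hq, smul_neg_iff_of_pos_left hq] at h₂
    exact ⟨h₁, h₂⟩

/-- Bounds `a`, `b` with `A ≤ a` and `b ≤ B` and distance more than `d`; nontriviality of `G` is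
needed when `A` or `B` is empty. -/
theorem exists_separating [Nontrivial G] (A B : Finset G) (d : G)
    (h : ∀ a ∈ A, ∀ b ∈ B, a + d < b) :
    ∃ a b : G, a + d < b ∧ (∀ x ∈ A, x ≤ a) ∧ ∀ x ∈ B, b ≤ x := by
  obtain ⟨e, he⟩ := exists_zero_lt (α := G)
  rcases A.eq_empty_or_nonempty with rfl | hA <;> rcases B.eq_empty_or_nonempty with rfl | hB
  · exact ⟨0, d + e, by simpa using he, by simp, by simp⟩
  · exact ⟨B.min' hB - d - e, B.min' hB, by
      rw [sub_right_comm, sub_add_cancel]; exact sub_lt_self _ he, by simp,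
      fun x hx => B.min'_le x hx⟩
  · exact ⟨A.max' hA, A.max' hA + d + e, by simpa using he, fun x hx => A.le_max' x hx, by simp⟩
  · exact ⟨A.max' hA, B.min' hB, h _ (A.max'_mem hA) _ (B.min'_mem hB),
      fun x hx => A.le_max' x hx, fun x hx => B.min'_le x hx⟩

/-- The elimination step: for finitely many affine functions in one more variable `y`, every
extension of `x.1` by some `y` is eventually matched by an extension of `x.2`, with the same signs
and the same divisibility by the divisors of `M`. -/
theorem eventually_extend [Nontrivial G] (hG : IsRegularOAG G) {κ : Type*} [Finite κ] {M : ℕ}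
    (hM : 0 < M) (k : κ → ℤ) (s : κ → (ι → G) → G) (hs : ∀ i, s i ∈ affine ι G) :
    ∀ᶠ x in agree ι G, ∀ y : G, ∃ y' : G, ∀ i,
      ((0 < k i • y + s i x.1 ↔ 0 < k i • y' + s i x.2) ∧
        (k i • y + s i x.1 < 0 ↔ k i • y' + s i x.2 < 0)) ∧
      ∀ d : ℕ, d ∣ M →
        (k i • y + s i x.1 ∈ multiples G d ↔ k i • y' + s i x.2 ∈ multiples G d) := by
  classical
  have := Fintype.ofFinite κ
  -- With `K` a common multiple of the coefficients, signs are read off from the position of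
  -- `z = K y` relative to the values `τ i x`.
  obtain ⟨K, hK, hkK⟩ : ∃ K : ℕ, 0 < K ∧ ∀ i, k i ≠ 0 → k i ∣ K := by
    refine ⟨∏ i, if k i = 0 then 1 else (k i).natAbs, Finset.prod_pos fun i _ => ?_,
      fun i hi => ?_⟩
    · split_ifs with h
      exacts [one_pos, Int.natAbs_pos.2 h]
    · have := Finset.dvd_prod_of_mem (fun i => if k i = 0 then 1 else (k i).natAbs)
        (Finset.mem_univ i)
      simp only [if_neg hi] at this
      exact Int.natAbs_dvd.1 (Int.natCast_dvd_natCast.2 this)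
  have hK' : (K : ℤ) ≠ 0 := by exact_mod_cast hK.ne'
  have hq : ∀ i, ∃ q : ℤ, k i ≠ 0 → (K : ℤ) = k i * q := fun i => by
    by_cases hi : k i = 0
    · exact ⟨0, fun h => absurd hi h⟩
    · obtain ⟨q, hq⟩ := hkK i hi
      exact ⟨q, fun _ => hq⟩
  choose q hq using hq
  obtain ⟨J, j₀, hJ₁, hJ₂⟩ := exists_interval_residues hG (Nat.mul_pos hK hM)
  set τ : κ → (ι → G) → G := fun i => (-q i) • s i with hτ
  have hτm : ∀ i, τ i ∈ affine ι G := fun i => AddSubgroup.zsmul_mem _ (hs i) _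
  have hτc : ∀ i (c : G), τ i + (fun _ => c) ∈ affine ι G := fun i c =>
    add_mem (hτm i) (const_mem_affine c)
  have h1 : ∀ᶠ x in agree ι G, ∀ i, (0 < s i x.1 ↔ 0 < s i x.2) ∧ (s i x.1 < 0 ↔ s i x.2 < 0) :=
    eventually_all.2 fun i => (eventually_pos_iff (hs i)).and
      (eventually_lt_iff (hs i) (const_mem_affine 0))
  have h2 : ∀ᶠ x in agree ι G, ∀ i l, ∀ c ∈ insert j₀ (insert 0 J),
      ((τ i x.1 + c < τ l x.1 ↔ τ i x.2 + c < τ l x.2) ∧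
        (τ l x.1 < τ i x.1 + c ↔ τ l x.2 < τ i x.2 + c)) :=
    eventually_all.2 fun i => eventually_all.2 fun l => (eventually_all_finset _).2 fun c _ =>
      (eventually_lt_iff (hτc i c) (hτm l)).and (eventually_lt_iff (hτm l) (hτc i c))
  have h3 : ∀ᶠ x in agree ι G, ∀ i, ∀ c ∈ insert 0 J,
      (τ i x.1 + c ∈ multiples G K ↔ τ i x.2 + c ∈ multiples G K) :=
    eventually_all.2 fun i => (eventually_all_finset _).2 fun c _ =>
      eventually_mem_multiples_iff (hτc i c) K
  have h4 : ∀ᶠ x in agree ι G, ∀ i l, ∀ c ∈ insert 0 J, ∀ d ∈ M.divisors,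
      (k l • (τ i x.1 + c) + (K : ℤ) • s l x.1 ∈ multiples G (K * d) ↔
        k l • (τ i x.2 + c) + (K : ℤ) • s l x.2 ∈ multiples G (K * d)) :=
    eventually_all.2 fun i => eventually_all.2 fun l => (eventually_all_finset _).2 fun c _ =>
      (eventually_all_finset _).2 fun d _ =>
        eventually_mem_multiples_iff (add_mem (AddSubgroup.zsmul_mem _ (hτc i c) (k l))
          (AddSubgroup.zsmul_mem _ (hs l) (K : ℤ))) (K * d : ℤ)
  filter_upwards [h1, h2, h3, h4, eventually_residues hM.ne' k s hs] with x h1 h2 h3 h4 h5 y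
  have sign : ∀ y' : G,
      (∀ l, (τ l x.1 < (K : ℤ) • y ↔ τ l x.2 < (K : ℤ) • y') ∧
        ((K : ℤ) • y < τ l x.1 ↔ (K : ℤ) • y' < τ l x.2)) →
      ∀ l, (0 < k l • y + s l x.1 ↔ 0 < k l • y' + s l x.2) ∧
        (k l • y + s l x.1 < 0 ↔ k l • y' + s l x.2 < 0) := fun y' h l => by
    by_cases hl : k l = 0
    · simpa [hl] using h1 l
    · have hKq := hq l hl
      have := h l
      rw [hKq] at this
      exact sign_congr (hKq ▸ by exact_mod_cast hK) this.1 this.2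
  by_cases hA : ∃ i, ∃ c ∈ insert 0 J, (K : ℤ) • y = τ i x.1 + c
  · -- `K y` is close to some `τ i x.1`: copy the difference.
    obtain ⟨i, c, hc, hy⟩ := hA
    obtain ⟨y', hy'⟩ := (h3 i c hc).1 ⟨y, hy⟩
    replace hy' : (K : ℤ) • y' = τ i x.2 + c := hy'
    refine ⟨y', fun l => ⟨sign y' (fun l => ?_) l, fun d hd => ?_⟩⟩
    · rw [hy, hy']
      exact (h2 i l c (Finset.mem_insert_of_mem hc)).symm
    · rw [← zsmul_mem_multiples_mul hK', ← zsmul_mem_multiples_mul hK' (g := k l • y' + s l x.2),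
        zsmul_add, zsmul_add, zsmul_comm _ (k l) (K : ℤ), hy, zsmul_comm _ (k l) (K : ℤ), hy']
      exact h4 i l c hc d (Nat.mem_divisors.2 ⟨hd, hM.ne'⟩)
  · -- `K y` is far from all `τ i x.1`: the corresponding interval over `x.2` is long.
    push Not at hA
    obtain ⟨w, hw⟩ := h5 y
    obtain ⟨a, b, hab, ha, hb⟩ := exists_separating
      ((Finset.univ.filter fun l => τ l x.1 < (K : ℤ) • y).image fun l => τ l x.2)
      ((Finset.univ.filter fun l => (K : ℤ) • y < τ l x.1).image fun l => τ l x.2) j₀ (by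
        simp only [Finset.mem_image, Finset.mem_filter, Finset.mem_univ, true_and]
        rintro _ ⟨i, hi, rfl⟩ _ ⟨l, hl, rfl⟩
        have := hJ₂ _ _ hi fun j hj => hA i j (Finset.mem_insert_of_mem hj)
        exact (h2 i l j₀ (Finset.mem_insert_self _ _)).1.1 (this.trans hl))
    simp only [Finset.mem_image, Finset.mem_filter, Finset.mem_univ, true_and,
      forall_exists_index, and_imp, forall_apply_eq_imp_iff₂] at ha hb
    obtain ⟨z, haz, hzb, u, hu⟩ := hJ₁ a b ((K : ℤ) • w) hab
    replace hu : ((K * M : ℕ) : ℤ) • u = z - (K : ℤ) • w := hu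
    have hz : (K : ℤ) • (w + (M : ℤ) • u) = z := by
      rw [zsmul_add, ← mul_zsmul, ← Nat.cast_mul, hu]; abel
    refine ⟨w + (M : ℤ) • u, fun l => ⟨sign _ (fun l => ?_) l, fun d hd => ?_⟩⟩
    · rw [hz]
      rcases lt_trichotomy (τ l x.1) ((K : ℤ) • y) with h | h | h
      · have h' := (ha l h).trans_lt haz
        exact ⟨iff_of_true h h', iff_of_false h.not_gt h'.not_gt⟩
      · exact absurd (by simp [h]) (hA l 0 (Finset.mem_insert_self _ _))
      · have h' := hzb.trans_le (hb l h)
        exact ⟨iff_of_false h.not_gt h'.not_gt, iff_of_true h h'⟩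
    · rw [hw l d hd, zsmul_add_mem_congr (y := w + (M : ℤ) • u) (w := w)]
      rw [add_sub_cancel_left]
      exact multiples_mono (Int.natCast_dvd_natCast.2 hd) (zsmul_mem_multiples _ u)

/-- The tuple `x` extended by `y` as last variable. -/
def extend {n : ℕ} (x : ι ⊕ Fin n → G) (y : G) : ι ⊕ Fin (n + 1) → G :=
  Sum.elim (x ∘ Sum.inl) (Fin.snoc (x ∘ Sum.inr) y)

omit [LinearOrder G] [IsOrderedAddMonoid G] in
theorem exists_affine_extend {n : ℕ} {t : (ι ⊕ Fin (n + 1) → G) → G}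
    (ht : t ∈ affine (ι ⊕ Fin (n + 1)) G) :
    ∃ (k : ℤ) (s : (ι ⊕ Fin n → G) → G), s ∈ affine (ι ⊕ Fin n) G ∧
      ∀ x y, t (extend x y) = k • y + s x := by
  refine affine_induction (P := fun t => ∃ (k : ℤ) (s : (ι ⊕ Fin n → G) → G),
    s ∈ affine (ι ⊕ Fin n) G ∧ ∀ x y, t (extend x y) = k • y + s x) ?_ ?_ ?_ ?_ ht
  · rintro (i | i)
    · exact ⟨0, _, coord_mem_affine (Sum.inl i), fun x y => by simp [extend]⟩
    · induction i using Fin.lastCases with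
      | last => exact ⟨1, _, zero_mem _, fun x y => by simp [extend]⟩
      | cast i => exact ⟨0, _, coord_mem_affine (Sum.inr i), fun x y => by simp [extend]⟩
  · exact fun g => ⟨0, _, const_mem_affine g, fun x y => by simp⟩
  · rintro t t' ⟨k, s, hs, h⟩ ⟨k', s', hs', h'⟩
    refine ⟨k + k', s + s', add_mem hs hs', fun x y => ?_⟩
    rw [Pi.add_apply, h, h', Pi.add_apply, add_zsmul]
    abel
  · rintro t ⟨k, s, hs, h⟩
    refine ⟨-k, -s, neg_mem hs, fun x y => ?_⟩
    rw [Pi.neg_apply, h, Pi.neg_apply, neg_zsmul]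
    abel

/-- Quantifier elimination for regular groups: the extension property of the agreement filter. -/
theorem eventually_exists_extend [Nontrivial G] (hG : IsRegularOAG G) {n : ℕ}
    {U : Set ((ι ⊕ Fin (n + 1) → G) × (ι ⊕ Fin (n + 1) → G))}
    (hU : U ∈ agree (ι ⊕ Fin (n + 1)) G) :
    ∀ᶠ x in agree (ι ⊕ Fin n) G, ∀ y, ∃ y', (extend x.1 y, extend x.2 y') ∈ U := by
  obtain ⟨S, hS, hSU⟩ := exists_finite_of_mem_agree hU
  have := hS.fintype
  choose k s hs hks using fun a : S => exists_affine_extend a.1.1.2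
  set M : ℕ := ∏ a : S, if a.1.2 = 0 then 1 else a.1.2.natAbs with hMdef
  have hM : 0 < M := Finset.prod_pos fun a _ => by
    split_ifs with h
    exacts [one_pos, Int.natAbs_pos.2 h]
  filter_upwards [eventually_extend hG hM k s hs] with x hx y
  obtain ⟨y', hy'⟩ := hx y
  refine ⟨y', hSU _ fun a ha => ?_⟩
  obtain ⟨⟨h1, h2⟩, h3⟩ := hy' ⟨a, ha⟩
  have e := hks ⟨a, ha⟩
  simp only at e
  simp only [e]
  refine ⟨h1, ?_⟩
  by_cases hm : a.2 = 0
  · rw [hm, mem_multiples_zero_iff, mem_multiples_zero_iff, h1, h2]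
  · rw [← multiples_natAbs]
    refine h3 _ ?_
    have := Finset.dvd_prod_of_mem (fun a : S => if a.1.2 = 0 then 1 else a.1.2.natAbs)
      (Finset.mem_univ ⟨a, ha⟩)
    simpa only [if_neg hm] using this

end Extend

/-! ### Definable sets -/

section Definable

variable {ι κ G : Type*} [AddCommGroup G] [LinearOrder G]

theorem tendsto_swap_agree : Tendsto Prod.swap (agree ι G) (agree ι G) :=
  tendsto_iInf.2 fun a => tendsto_principal.2 <|
    mem_of_superset (mem_iInf_of_mem a (mem_principal_self _)) fun _ hp => ⟨hp.1.symm, hp.2.symm⟩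

omit [LinearOrder G] in
theorem affine_comp {g : (ι → G) → κ → G} (hg : ∀ j, (fun x => g x j) ∈ affine ι G)
    {t : (κ → G) → G} (ht : t ∈ affine κ G) : (fun x => t (g x)) ∈ affine ι G :=
  affine_induction (P := fun t => (fun x => t (g x)) ∈ affine ι G) hg const_mem_affine
    (fun _ _ hs ht => add_mem hs ht) (fun _ hs => neg_mem hs) ht

theorem tendsto_agree {g : (ι → G) → κ → G} (hg : ∀ j, (fun x => g x j) ∈ affine ι G) :
    Tendsto (Prod.map g g) (agree ι G) (agree κ G) :=
  tendsto_iInf.2 fun a => tendsto_principal.2 <|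
    (eventually_pos_iff (affine_comp hg a.1.2)).and
      (eventually_mem_multiples_iff (affine_comp hg a.1.2) a.2)

theorem realize_mem_affine (t : Language.oag.Term ι) :
    (fun x : ι → G => t.realize x) ∈ affine ι G := by
  induction t with
  | var i => exact coord_mem_affine i
  | func f ts ih =>
    cases f with
    | zero => exact zero_mem _
    | neg => exact neg_mem (ih 0)
    | add => exact add_mem (ih 0) (ih 1)

variable [IsOrderedAddMonoid G] [Nontrivial G]

theorem eventually_realize_iff (hG : IsRegularOAG G) {n : ℕ}
    (φ : Language.oag.BoundedFormula ι n) :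
    ∀ᶠ x in agree (ι ⊕ Fin n) G, φ.Realize (x.1 ∘ Sum.inl) (x.1 ∘ Sum.inr) ↔
      φ.Realize (x.2 ∘ Sum.inl) (x.2 ∘ Sum.inr) := by
  induction φ with
  | falsum => exact .of_forall fun x => Iff.rfl
  | equal t₁ t₂ =>
    filter_upwards [eventually_lt_iff (realize_mem_affine t₁) (realize_mem_affine t₂),
      eventually_lt_iff (realize_mem_affine t₂) (realize_mem_affine t₁)] with x h₁ h₂
    simp only [Language.BoundedFormula.Realize, Sum.elim_comp_inl_inr]
    rw [le_antisymm_iff, le_antisymm_iff, ← not_lt, ← not_lt, h₁, h₂, not_lt, not_lt]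
  | rel R ts =>
    cases R
    filter_upwards [eventually_lt_iff (realize_mem_affine (ts 0)) (realize_mem_affine (ts 1))]
      with x h
    simp only [Language.BoundedFormula.Realize, Sum.elim_comp_inl_inr]
    exact h
  | imp φ ψ ihφ ihψ =>
    filter_upwards [ihφ, ihψ] with x h₁ h₂
    simp only [Language.BoundedFormula.Realize, h₁, h₂]
  | all φ ih =>
    have h := eventually_exists_extend hG ih
    filter_upwards [h, tendsto_swap_agree.eventually h] with x h₁ h₂
    simp only [Language.BoundedFormula.Realize]
    refine ⟨fun H a => ?_, fun H a => ?_⟩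
    · obtain ⟨b, hb⟩ := h₂ a
      exact hb.2 (H b)
    · obtain ⟨b, hb⟩ := h₁ a
      exact hb.2 (H b)

/-- In a regular group, membership in a definable set is decided by the signs and divisibility of
finitely many affine functions. -/
theorem eventually_mem_iff_of_definable (hG : IsRegularOAG G) {s : Set (ι → G)}
    (hs : (Set.univ : Set G).Definable Language.oag s) :
    ∀ᶠ x in agree ι G, x.1 ∈ s ↔ x.2 ∈ s := by
  obtain ⟨φ, rfl⟩ := Set.definable_iff_exists_formula_sum.1 hs
  have h := eventually_realize_iff hG φ
  have ht : Tendsto _ (agree ι G) (agree (((Set.univ : Set G) ⊕ ι) ⊕ Fin 0) G) :=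
    tendsto_agree (g := fun x => Sum.elim (Sum.elim (↑) x) default) (by
      rintro ((a | i) | j)
      exacts [const_mem_affine _, coord_mem_affine i, j.elim0])
  exact ht.eventually h

end Definable

/-! ### Sets defined by affine functions -/

section AffineDefinable

/-- The symbol `<` of the language of ordered abelian groups. -/
def ltSymb : Language.oag.Relations 2 := OAGRel.lt

/-- The symbol `+` of the language of ordered abelian groups. -/
def addSymb : Language.oag.Functions 2 := OAGFunc.add

/-- The symbol `-` of the language of ordered abelian groups. -/
def negSymb : Language.oag.Functions 1 := OAGFunc.neg

/-- The symbol `0` of the language of ordered abelian groups. -/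
def zeroSymb : Language.oag.Functions 0 := OAGFunc.zero

variable {ι G : Type*} [AddCommGroup G] [LinearOrder G]

theorem exists_term_of_mem_affine {t : (ι → G) → G} (ht : t ∈ affine ι G) :
    ∃ τ : Language.oag.Term ((Set.univ : Set G) ⊕ ι),
      ∀ x : ι → G, τ.realize (Sum.elim (↑) x) = t x := by
  refine affine_induction (P := fun t => ∃ τ : Language.oag.Term ((Set.univ : Set G) ⊕ ι),
      ∀ x : ι → G, τ.realize (Sum.elim (↑) x) = t x) ?_ ?_ ?_ ?_ ht
  · exact fun i => ⟨.var (Sum.inr i), fun x => rfl⟩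
  · exact fun g => ⟨.var (Sum.inl ⟨g, trivial⟩), fun x => rfl⟩
  · rintro s t ⟨σ, hσ⟩ ⟨τ, hτ⟩
    exact ⟨.func addSymb ![σ, τ], fun x => congrArg₂ (· + ·) (hσ x) (hτ x)⟩
  · rintro s ⟨σ, hσ⟩
    exact ⟨.func negSymb ![σ], fun x => congrArg (- ·) (hσ x)⟩

theorem definable_lt {s t : (ι → G) → G} (hs : s ∈ affine ι G) (ht : t ∈ affine ι G) :
    (Set.univ : Set G).Definable Language.oag {x | s x < t x} := by
  obtain ⟨σ, hσ⟩ := exists_term_of_mem_affine hs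
  obtain ⟨τ, hτ⟩ := exists_term_of_mem_affine ht
  refine Set.definable_iff_exists_formula_sum.2
    ⟨ltSymb.formula₂ σ τ, ?_⟩
  ext x
  rw [Set.mem_ofPred_eq, Set.mem_ofPred_eq, Language.Formula.realize_rel₂, hσ, hτ]
  rfl

theorem definable_eq {s t : (ι → G) → G} (hs : s ∈ affine ι G) (ht : t ∈ affine ι G) :
    (Set.univ : Set G).Definable Language.oag {x | s x = t x} := by
  obtain ⟨σ, hσ⟩ := exists_term_of_mem_affine hs
  obtain ⟨τ, hτ⟩ := exists_term_of_mem_affine ht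
  refine Set.definable_iff_exists_formula_sum.2 ⟨σ.equal τ, ?_⟩
  ext x
  rw [Set.mem_ofPred_eq, Set.mem_ofPred_eq, Language.Formula.realize_equal, hσ, hτ]

theorem definable_mem_multiples {t : (ι → G) → G} (ht : t ∈ affine ι G) (m : ℤ) :
    (Set.univ : Set G).Definable Language.oag {x | t x ∈ multiples G m} := by
  have h1 : (fun z : ι ⊕ Fin 1 → G => t (z ∘ Sum.inl)) ∈ affine (ι ⊕ Fin 1) G :=
    affine_comp (g := fun z => z ∘ Sum.inl) (fun j => coord_mem_affine (Sum.inl j)) ht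
  have h2 : (m • fun z : ι ⊕ Fin 1 → G => z (Sum.inr 0)) ∈ affine (ι ⊕ Fin 1) G :=
    AddSubgroup.zsmul_mem _ (coord_mem_affine (Sum.inr 0)) m
  convert (definable_eq h2 h1).image_comp_sumInl_fin 1 using 1
  ext x
  constructor
  · rintro ⟨u, hu⟩
    exact ⟨Sum.elim x fun _ => u, hu, rfl⟩
  · rintro ⟨z, hz, rfl⟩
    exact ⟨z (Sum.inr 0), hz⟩

end AffineDefinable

/-- A set determined by membership in finitely many definable sets is definable. -/
theorem definable_of_determined {L : Language} {M α : Type*} [L.Structure M] {A : Set M}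
    {X : Set (α → M)} {T : Set (Set (α → M))} (hT : T.Finite) (hTd : ∀ D ∈ T, A.Definable L D)
    (h : ∀ x x', (∀ D ∈ T, x ∈ D ↔ x' ∈ D) → (x ∈ X ↔ x' ∈ X)) : A.Definable L X := by
  suffices ∀ B : Set (α → M), A.Definable L B →
      (∀ x ∈ B, ∀ x' ∈ B, (∀ D ∈ T, x ∈ D ↔ x' ∈ D) → (x ∈ X ↔ x' ∈ X)) →
      A.Definable L (X ∩ B) by
    simpa using this Set.univ Set.definable_univ fun x _ x' _ => h x x'
  clear h
  induction T, hT using Set.Finite.induction_on with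
  | empty =>
    intro B hB h
    rcases (X ∩ B).eq_empty_or_nonempty with h0 | ⟨x, hx, hxB⟩
    · rw [h0]; exact Set.definable_empty
    · convert hB using 1
      exact Set.inter_eq_right.2 fun y hy => (h x hxB y hy (by simp)).1 hx
  | @insert D T _ _ ih =>
    intro B hB h
    have hD := hTd D (Set.mem_insert _ _)
    have ih' := ih fun D' hD' => hTd D' (Set.mem_insert_of_mem _ hD')
    have e : X ∩ B = X ∩ (B ∩ D) ∪ X ∩ (B ∩ Dᶜ) := by
      rw [← Set.inter_union_distrib_left, ← Set.inter_union_distrib_left, Set.union_compl_self,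
        Set.inter_univ]
    rw [e]
    refine (ih' _ (hB.inter hD) fun x hx x' hx' hxx => ?_).union
      (ih' _ (hB.inter hD.compl) fun x hx x' hx' hxx => ?_)
    · exact h x hx.1 x' hx'.1 ((Set.forall_mem_insert).2 ⟨iff_of_true hx.2 hx'.2, hxx⟩)
    · exact h x hx.1 x' hx'.1 ((Set.forall_mem_insert).2 ⟨iff_of_false hx.2 hx'.2, hxx⟩)

/-! ### Definable cuts -/

section Cuts

theorem mem_right_iff {X : Type*} [LinearOrder X] (c : OrderCut X) {x : X} :
    x ∈ c.right ↔ x ∉ c.left := by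
  refine ⟨fun hr hl => lt_irrefl _ (c.lt x hl x hr), fun hl => ?_⟩
  exact ((Set.mem_union _ _ _).1 (c.union_eq ▸ Set.mem_univ x)).resolve_left hl

theorem mem_left_iff {X : Type*} [LinearOrder X] (c : OrderCut X) {x : X} :
    x ∈ c.left ↔ x ∉ c.right := by rw [mem_right_iff, not_not]

theorem mem_left_of_le {X : Type*} [LinearOrder X] (c : OrderCut X) {x y : X} (hxy : x ≤ y)
    (hy : y ∈ c.left) : x ∈ c.left := by
  by_contra hx
  exact absurd hxy (not_le.2 (c.lt y hy x ((mem_right_iff c).2 hx)))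

theorem mem_right_of_le {X : Type*} [LinearOrder X] (c : OrderCut X) {x y : X} (hxy : x ≤ y)
    (hx : x ∈ c.right) : y ∈ c.right :=
  (mem_right_iff c).2 fun hy => (mem_right_iff c).1 hx (mem_left_of_le c hxy hy)

theorem isDefinable_of_left {G : Type*} [AddCommGroup G] [LinearOrder G] {c : OrderCut G}
    (h : (Set.univ : Set G).Definable₁ Language.oag c.left) : c.IsDefinable := by
  refine ⟨h, ?_⟩
  have e : {x : Fin 1 → G | x 0 ∈ c.right} = {x : Fin 1 → G | x 0 ∈ c.left}ᶜ :=
    Set.ext fun x => mem_right_iff c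
  rw [Set.Definable₁, e]
  exact Set.Definable.compl h

theorem isDefinable_of_right {G : Type*} [AddCommGroup G] [LinearOrder G] {c : OrderCut G}
    (h : (Set.univ : Set G).Definable₁ Language.oag c.right) : c.IsDefinable := by
  refine ⟨?_, h⟩
  have e : {x : Fin 1 → G | x 0 ∈ c.left} = {x : Fin 1 → G | x 0 ∈ c.right}ᶜ :=
    Set.ext fun x => mem_left_iff c
  rw [Set.Definable₁, e]
  exact Set.Definable.compl h

variable {G : Type*} [AddCommGroup G] [LinearOrder G] [IsOrderedAddMonoid G]

theorem mk_lt_coe {g x : G} {n : ℕ+} :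
    DivisibleHull.mk g n < (x : DivisibleHull G) ↔ g < (n : ℕ) • x := by
  rw [DivisibleHull.mk_lt_mk]; simp

theorem coe_lt_mk {g x : G} {n : ℕ+} :
    (x : DivisibleHull G) < DivisibleHull.mk g n ↔ (n : ℕ) • x < g := by
  rw [DivisibleHull.mk_lt_mk]; simp

theorem coe_lt_coe_hull {x y : G} : (x : DivisibleHull G) < y ↔ x < y := by
  rw [DivisibleHull.mk_lt_mk]; simp

theorem isInftyOrRational_of_isGreatest {c : OrderCut G} {l : G} (h : IsGreatest c.left l) :
    c.IsInftyOrRational := by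
  refine Or.inr (Or.inr ⟨l, 1, Or.inl (Set.ext fun x => ?_)⟩)
  rw [Set.mem_ofPred_eq, coe_lt_coe_hull]
  refine ⟨fun hx => c.lt l h.1 x hx, fun hx => (mem_right_iff c).2 fun hx' => ?_⟩
  exact absurd (h.2 hx') (not_le.2 hx)

theorem isInftyOrRational_of_isLeast {c : OrderCut G} {r : G} (h : IsLeast c.right r) :
    c.IsInftyOrRational := by
  refine Or.inr (Or.inr ⟨r, 1, Or.inr (Set.ext fun x => ?_)⟩)
  rw [Set.mem_ofPred_eq, coe_lt_coe_hull]
  refine ⟨fun hx => c.lt x hx r h.1, fun hx => (mem_left_iff c).2 fun hx' => ?_⟩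
  exact absurd (h.2 hx') (not_le.2 hx)

theorem isDefinable_of_isInftyOrRational {c : OrderCut G} (h : c.IsInftyOrRational) :
    c.IsDefinable := by
  have hx : (fun x : Fin 1 → G => x 0) ∈ affine (Fin 1) G := coord_mem_affine 0
  rcases h with h | h | ⟨g, n, h | h⟩
  · refine isDefinable_of_left ?_
    rw [show c.left = ∅ from h]
    exact Set.definable_empty
  · refine isDefinable_of_right ?_
    rw [show c.right = ∅ from h]
    exact Set.definable_empty
  · refine isDefinable_of_right ?_
    rw [show c.right = _ from h]
    simp only [mk_lt_coe]
    exact definable_lt (const_mem_affine g) (AddSubgroup.nsmul_mem _ hx n)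
  · refine isDefinable_of_left ?_
    rw [show c.left = _ from h]
    simp only [coe_lt_mk]
    exact definable_lt (AddSubgroup.nsmul_mem _ hx n) (const_mem_affine g)

/-- The sign of a non-constant affine function changes at a rational point, hence not at a cut
that is not rational. -/
theorem exists_sign_const {c : OrderCut G} (hc : ¬ c.IsInftyOrRational) (k : ℤ) (g : G) :
    ∃ l ∈ c.left, ∃ r ∈ c.right, ∀ y ∈ Set.Icc l r, ∀ y' ∈ Set.Icc l r,
      (0 < k • y + g ↔ 0 < k • y' + g) := by
  have hL : c.left.Nonempty := Set.nonempty_iff_ne_empty.2 fun h => hc (Or.inl h)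
  have hR : c.right.Nonempty := Set.nonempty_iff_ne_empty.2 fun h => hc (Or.inr (Or.inl h))
  obtain ⟨l, hl⟩ := hL
  obtain ⟨r, hr⟩ := hR
  rcases lt_trichotomy k 0 with hk | rfl | hk
  · obtain ⟨n, hn⟩ := Int.eq_ofNat_of_zero_le (neg_nonneg.2 hk.le)
    obtain ⟨n, rfl⟩ : ∃ m : ℕ+, (m : ℕ) = n := ⟨⟨n, by omega⟩, rfl⟩
    obtain rfl : k = -((n : ℕ) : ℤ) := by omega
    have e : ∀ y : G, 0 < (-((n : ℕ) : ℤ)) • y + g ↔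
        (y : DivisibleHull G) < DivisibleHull.mk g n := fun y => by
      rw [coe_lt_mk, neg_zsmul, natCast_zsmul, lt_neg_add_iff_add_lt, add_zero]
    simp only [e]
    have hne : ¬ ∀ x, x ∈ c.left ↔ (x : DivisibleHull G) < DivisibleHull.mk g n := fun h =>
      hc (Or.inr (Or.inr ⟨g, n, Or.inr (Set.ext h)⟩))
    push Not at hne
    obtain ⟨x, ⟨hx, hxq⟩ | ⟨hx, hxq⟩⟩ := hne
    · have : ∀ y ∈ Set.Icc x r, ¬ (y : DivisibleHull G) < DivisibleHull.mk g n := fun y hy =>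
        not_lt.2 (hxq.trans (not_lt.1 (coe_lt_coe_hull.not.2 (not_lt.2 hy.1))))
      exact ⟨x, hx, r, hr, fun y hy y' hy' => iff_of_false (this y hy) (this y' hy')⟩
    · have : ∀ y ∈ Set.Icc l x, (y : DivisibleHull G) < DivisibleHull.mk g n := fun y hy =>
        (not_lt.1 (coe_lt_coe_hull.not.2 (not_lt.2 hy.2))).trans_lt hxq
      exact ⟨l, hl, x, (mem_right_iff c).2 hx, fun y hy y' hy' =>
        iff_of_true (this y hy) (this y' hy')⟩
  · exact ⟨l, hl, r, hr, fun y _ y' _ => by simp⟩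
  · obtain ⟨n, rfl⟩ := Int.eq_ofNat_of_zero_le hk.le
    obtain ⟨n, rfl⟩ : ∃ m : ℕ+, (m : ℕ) = n := ⟨⟨n, by omega⟩, rfl⟩
    have e : ∀ y : G, 0 < ((n : ℕ) : ℤ) • y + g ↔
        DivisibleHull.mk (-g) n < (y : DivisibleHull G) := fun y => by
      rw [mk_lt_coe, natCast_zsmul, neg_lt_iff_pos_add]
    simp only [e]
    have hne : ¬ ∀ x, x ∈ c.right ↔ DivisibleHull.mk (-g) n < (x : DivisibleHull G) := fun h =>
      hc (Or.inr (Or.inr ⟨-g, n, Or.inl (Set.ext h)⟩))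
    push Not at hne
    obtain ⟨x, ⟨hx, hxq⟩ | ⟨hx, hxq⟩⟩ := hne
    · have : ∀ y ∈ Set.Icc l x, ¬ DivisibleHull.mk (-g) n < (y : DivisibleHull G) := fun y hy =>
        not_lt.2 ((not_lt.1 (coe_lt_coe_hull.not.2 (not_lt.2 hy.2))).trans hxq)
      exact ⟨l, hl, x, hx, fun y hy y' hy' => iff_of_false (this y hy) (this y' hy')⟩
    · have : ∀ y ∈ Set.Icc x r, DivisibleHull.mk (-g) n < (y : DivisibleHull G) := fun y hy =>
        hxq.trans_le (not_lt.1 (coe_lt_coe_hull.not.2 (not_lt.2 hy.1)))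
      exact ⟨x, (mem_left_iff c).2 hx, r, hr, fun y hy y' hy' =>
        iff_of_true (this y hy) (this y' hy')⟩

theorem exists_sign_const_finite {c : OrderCut G} (hc : ¬ c.IsInftyOrRational) {T : Set (ℤ × G)}
    (hT : T.Finite) :
    ∃ l ∈ c.left, ∃ r ∈ c.right, ∀ a ∈ T, ∀ y ∈ Set.Icc l r, ∀ y' ∈ Set.Icc l r,
      (0 < a.1 • y + a.2 ↔ 0 < a.1 • y' + a.2) := by
  induction T, hT using Set.Finite.induction_on with
  | empty =>
    obtain ⟨l, hl, r, hr, _⟩ := exists_sign_const hc 0 0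
    exact ⟨l, hl, r, hr, by simp⟩
  | @insert a T _ _ ih =>
    obtain ⟨l, hl, r, hr, h⟩ := ih
    obtain ⟨l', hl', r', hr', h'⟩ := exists_sign_const hc a.1 a.2
    refine ⟨max l l', ?_, min r r', ?_, ?_⟩
    · rcases max_choice l l' with e | e <;> rw [e] <;> assumption
    · rcases min_choice r r' with e | e <;> rw [e] <;> assumption
    · have h1 : Set.Icc (max l l') (min r r') ⊆ Set.Icc l r :=
        Set.Icc_subset_Icc (le_max_left _ _) (min_le_left _ _)
      have h2 : Set.Icc (max l l') (min r r') ⊆ Set.Icc l' r' :=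
        Set.Icc_subset_Icc (le_max_right _ _) (min_le_right _ _)
      exact Set.forall_mem_insert.2 ⟨fun y hy y' hy' => h' y (h2 hy) y' (h2 hy'),
        fun b hb y hy y' hy' => h b hb y (h1 hy) y' (h1 hy')⟩

omit [LinearOrder G] [IsOrderedAddMonoid G] in
theorem exists_affine_one {t : (Fin 1 → G) → G} (ht : t ∈ affine (Fin 1) G) :
    ∃ (k : ℤ) (g : G), ∀ y, t (fun _ => y) = k • y + g := by
  refine affine_induction (P := fun t => ∃ (k : ℤ) (g : G), ∀ y, t (fun _ => y) = k • y + g)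
    (fun i => ⟨1, 0, by simp⟩) (fun g => ⟨0, g, by simp⟩) ?_ ?_ ht
  · rintro s t ⟨k, g, h⟩ ⟨k', g', h'⟩
    exact ⟨k + k', g + g', fun y => by rw [Pi.add_apply, h, h', add_zsmul]; abel⟩
  · rintro s ⟨k, g, h⟩
    exact ⟨-k, -g, fun y => by rw [Pi.neg_apply, h, neg_zsmul]; abel⟩

/-- Near a cut that is not rational the signs of finitely many affine functions are constant,
while each residue class accumulates at both sides; so no such cut is definable. -/
theorem isInftyOrRational_of_isDefinable [Nontrivial G] (hG : IsRegularOAG G) {c : OrderCut G}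
    (h : c.IsDefinable) : c.IsInftyOrRational := by
  by_contra hc
  obtain ⟨S, hS, hSU⟩ := exists_finite_of_mem_agree (eventually_mem_iff_of_definable hG h.1)
  have := hS.fintype
  choose k g hkg using fun a : S => exists_affine_one a.1.1.2
  set M : ℕ := ∏ a : S, if a.1.2 = 0 then 1 else a.1.2.natAbs
  have hM : 0 < M := Finset.prod_pos fun a _ => by
    split_ifs with h
    exacts [one_pos, Int.natAbs_pos.2 h]
  obtain ⟨J, j₀, hJ₁, hJ₂⟩ := exists_interval_residues hG hM
  obtain ⟨l, hl, r, hr, hconst⟩ := exists_sign_const_finite hc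
    ((Set.finite_range fun a : S => (k a, g a)).union
      (Set.finite_range fun a : S => (-k a, -g a)))
  -- As `c.right` has no least element, it contains points far below `r`.
  obtain ⟨r', hr', hr'r, hJ⟩ : ∃ r' ∈ c.right, r' < r ∧ ∀ j ∈ J, r ≠ r' + j := by
    by_contra! hne
    have hfin : {x ∈ c.right | x ≤ r}.Finite := by
      refine ((J.image fun j => r - j).finite_toSet.insert r).subset fun x hx => ?_
      rcases hx.2.eq_or_lt with rfl | hlt
      · exact Set.mem_insert _ _
      · obtain ⟨j, hj, hjr⟩ := hne x hx.1 hlt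
        refine Set.mem_insert_of_mem _ (Finset.mem_coe.2 (Finset.mem_image.2 ⟨j, hj, ?_⟩))
        rw [hjr, add_sub_cancel_right]
    obtain ⟨m, hm, hmin⟩ := Set.exists_min_image _ id hfin ⟨r, hr, le_rfl⟩
    refine hc (isInftyOrRational_of_isLeast ⟨hm.1, fun x hx => ?_⟩)
    rcases le_total x r with hxr | hxr
    · exact hmin x ⟨hx, hxr⟩
    · exact hm.2.trans hxr
  obtain ⟨z, hz, hzr, hzl⟩ := hJ₁ r' r l (hJ₂ r' r hr'r hJ)
  have hzR : z ∈ c.right := mem_right_of_le c hz.le hr'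
  have hlI : l ∈ Set.Icc l r := ⟨le_rfl, (c.lt l hl r hr).le⟩
  have hzI : z ∈ Set.Icc l r := ⟨(c.lt l hl z hzR).le, hzr.le⟩
  have key := hSU (fun _ => l, fun _ => z) fun a ha => by
    have e := hkg ⟨a, ha⟩
    simp only at e
    simp only [e]
    have h1 := hconst _ (Or.inl ⟨⟨a, ha⟩, rfl⟩) l hlI z hzI
    refine ⟨h1, ?_⟩
    by_cases hm : a.2 = 0
    · have h2 := hconst _ (Or.inr ⟨⟨a, ha⟩, rfl⟩) l hlI z hzI
      simp only [neg_zsmul, ← neg_add, neg_pos] at h2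
      rw [hm, mem_multiples_zero_iff, mem_multiples_zero_iff, h1, h2]
    · rw [← multiples_natAbs]
      have hdvd := Finset.dvd_prod_of_mem (fun a : S => if a.1.2 = 0 then 1 else a.1.2.natAbs)
        (Finset.mem_univ ⟨a, ha⟩)
      simp only [if_neg hm] at hdvd
      exact (zsmul_add_mem_congr (multiples_mono (Int.natCast_dvd_natCast.2 hdvd) hzl) _ _).symm
  exact (mem_right_iff c).1 hzR (key.1 hl)

theorem isDefinable_iff_isInftyOrRational [Nontrivial G] (hG : IsRegularOAG G) (c : OrderCut G) :
    c.IsDefinable ↔ c.IsInftyOrRational :=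
  ⟨isInftyOrRational_of_isDefinable hG, isDefinable_of_isInftyOrRational⟩

end Cuts

/-! ### Stable embeddedness -/

section Stable

variable {G : Type*} [AddCommGroup G] [LinearOrder G]

/-- The trace on `G` of an initial segment of a stably embedding extension is definable. -/
theorem isDefinable_of_stablyEmbeddedIn {N : Type*} [Language.oag.Structure N]
    {f : G ↪ₑ[Language.oag] N} (hf : StablyEmbeddedIn f) {c : OrderCut G} (a : N)
    (hl : ∀ l ∈ c.left, Language.Structure.RelMap ltSymb ![f l, a])
    (hr : ∀ r ∈ c.right, ¬ Language.Structure.RelMap ltSymb ![f r, a]) : c.IsDefinable := by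
  have hD : (Set.univ : Set N).Definable Language.oag
      {x : Fin 1 → N | Language.Structure.RelMap ltSymb ![x 0, a]} := by
    refine Set.definable_iff_exists_formula_sum.2
      ⟨ltSymb.formula₂ (.var (Sum.inr 0)) (.var (Sum.inl ⟨a, trivial⟩)), ?_⟩
    ext x
    rw [Set.mem_ofPred_eq, Set.mem_ofPred_eq, Language.Formula.realize_rel₂]
    rfl
  refine isDefinable_of_left ?_
  have e : {x : Fin 1 → G | x 0 ∈ c.left} = {x : Fin 1 → G | (fun i => f (x i)) ∈
      {x : Fin 1 → N | Language.Structure.RelMap ltSymb ![x 0, a]}} :=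
    Set.ext fun x => ⟨fun hx => hl _ hx, fun hx => (mem_left_iff c).2 fun h => hr _ h hx⟩
  rw [Set.Definable₁, e]
  exact hf 1 _ hD

variable {H : Type*} [AddCommGroup H] [LinearOrder H] (f : G ↪ₑ[Language.oag] H)

theorem elementary_map_add (a b : G) : f (a + b) = f a + f b :=
  f.map_fun addSymb ![a, b]

theorem elementary_map_neg (a : G) : f (-a) = -f a :=
  f.map_fun negSymb ![a]

theorem elementary_lt_iff (a b : G) : f a < f b ↔ a < b :=
  f.map_rel ltSymb ![a, b]

/-- The term `n • t`. -/
def nsmulTerm {α : Type*} (t : Language.oag.Term α) : ℕ → Language.oag.Term α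
  | 0 => .func zeroSymb ![]
  | n + 1 => .func addSymb ![nsmulTerm t n, t]

theorem realize_nsmulTerm {α : Type*} (t : Language.oag.Term α) (n : ℕ) (v : α → G) :
    (nsmulTerm t n).realize v = n • t.realize v := by
  induction n with
  | zero => rw [zero_nsmul]; rfl
  | succ n ih =>
    rw [succ_nsmul, ← ih]
    rfl

/-- The formula `∃ y, n • y = x`. -/
def dvdFormula (n : ℕ) : Language.oag.Formula (Fin 1) :=
  ((nsmulTerm (.var (Sum.inr 0)) n).bdEqual (.var (Sum.inl 0)) :
    Language.oag.BoundedFormula (Fin 1) 1).ex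

theorem realize_dvdFormula (n : ℕ) (g : G) :
    (dvdFormula n).Realize ![g] ↔ g ∈ multiples G n := by
  simp only [dvdFormula, Language.Formula.Realize, Language.BoundedFormula.realize_ex,
    Language.BoundedFormula.realize_bdEqual, realize_nsmulTerm, mem_multiples, natCast_zsmul]
  rfl

theorem elementary_mem_multiples_iff (m : ℤ) (g : G) :
    f g ∈ multiples H m ↔ g ∈ multiples G m := by
  rw [← multiples_natAbs (G := H) m, ← multiples_natAbs (G := G) m, ← realize_dvdFormula,
    ← realize_dvdFormula, ← f.map_formula]
  exact iff_of_eq (congrArg _ (funext fun i => by fin_cases i; rfl))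

variable [IsOrderedAddMonoid G] [IsOrderedAddMonoid H]

omit [IsOrderedAddMonoid G] in
/-- The restriction to `G` of an affine function over `H` is a translate of an affine function
over `G`. -/
theorem exists_affine_trace {ι : Type*} {t : (ι → H) → H} (ht : t ∈ affine ι H) :
    ∃ (s : (ι → G) → G) (h : H), s ∈ affine ι G ∧ ∀ x, t (fun i => f (x i)) = f (s x) + h := by
  have f0 : f 0 = 0 := by simpa using elementary_map_add f 0 0
  refine affine_induction (P := fun t => ∃ (s : (ι → G) → G) (h : H), s ∈ affine ι G ∧
    ∀ x, t (fun i => f (x i)) = f (s x) + h) ?_ ?_ ?_ ?_ ht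
  · exact fun i => ⟨_, 0, coord_mem_affine i, fun x => by simp⟩
  · exact fun h => ⟨0, h, zero_mem _, fun x => by simp [f0]⟩
  · rintro t t' ⟨s, h, hs, e⟩ ⟨s', h', hs', e'⟩
    refine ⟨s + s', h + h', add_mem hs hs', fun x => ?_⟩
    rw [Pi.add_apply, e, e', Pi.add_apply, elementary_map_add]
    abel
  · rintro t ⟨s, h, hs, e⟩
    refine ⟨-s, -h, neg_mem hs, fun x => ?_⟩
    rw [Pi.neg_apply, e, Pi.neg_apply, elementary_map_neg]
    abel

/-- The trace on `G` of an open half-space over `H`, if all cuts of `G` realised in `H` are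
rational. -/
theorem definable_trace_pos
    (hc : ∀ c : OrderCut G, c.IsRealisedIn f → c.IsInftyOrRational)
    {ι : Type*} {t : (ι → H) → H} (ht : t ∈ affine ι H) :
    (Set.univ : Set G).Definable Language.oag {x : ι → G | 0 < t (fun i => f (x i))} := by
  obtain ⟨s, h, hs, e⟩ := exists_affine_trace f ht
  have e' : ∀ x, 0 < t (fun i => f (x i)) ↔ -h < f (s x) := fun x => by
    rw [e, neg_lt_iff_pos_add]
  simp only [e']
  by_cases hg : ∃ g, f g = -h
  · obtain ⟨g, hg⟩ := hg
    simp only [← hg, elementary_lt_iff]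
    exact definable_lt (const_mem_affine g) hs
  · push Not at hg
    -- The cut that `-h` realises in `G`.
    let c : OrderCut G :=
      { left := {g | f g < -h}
        right := {g | -h < f g}
        union_eq := Set.eq_univ_of_forall fun g => (hg g).lt_or_gt
        lt := fun a ha b hb => (elementary_lt_iff f a b).1 (ha.trans hb) }
    rcases hc c ⟨-h, fun l hl => hl, fun r hr => hr⟩ with hb | hb | ⟨g, n, hb | hb⟩
    · convert Set.definable_univ using 1
      refine Set.eq_univ_of_forall fun x => (mem_right_iff c).2 fun hx => ?_
      rw [show c.left = ∅ from hb] at hx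
      exact hx
    · convert Set.definable_empty using 1
      exact Set.eq_empty_of_forall_notMem fun x hx =>
        Set.notMem_empty (s x) ((show c.right = ∅ from hb) ▸ hx)
    · convert definable_lt (const_mem_affine g) (AddSubgroup.nsmul_mem _ hs n) using 1
      ext x
      exact (Set.ext_iff.1 hb (s x)).trans mk_lt_coe
    · convert (definable_lt (AddSubgroup.nsmul_mem _ hs n) (const_mem_affine g)).compl using 1
      ext x
      exact (mem_right_iff c).trans (not_congr ((Set.ext_iff.1 hb (s x)).trans coe_lt_mk))

omit [IsOrderedAddMonoid G] in
theorem definable_trace_mem_multiples {ι : Type*} {t : (ι → H) → H} (ht : t ∈ affine ι H)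
    (m : ℤ) :
    (Set.univ : Set G).Definable Language.oag
      {x : ι → G | t (fun i => f (x i)) ∈ multiples H m} := by
  obtain ⟨s, h, hs, e⟩ := exists_affine_trace f ht
  simp only [e]
  by_cases hg : ∃ g : G, f g + h ∈ multiples H m
  · obtain ⟨g, hg⟩ := hg
    -- `m ∣ s x + h` if and only if `m ∣ s x - g`.
    have e' : ∀ y : G, f y + h ∈ multiples H m ↔ y + -g ∈ multiples G m := fun y => by
      rw [← elementary_mem_multiples_iff f, elementary_map_add, elementary_map_neg,
        ← AddSubgroup.add_mem_cancel_right _ hg (y := f y + -f g)]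
      rw [show f y + -f g + (f g + h) = f y + h by abel]
    simp only [e']
    exact definable_mem_multiples (add_mem hs (const_mem_affine (-g))) m
  · push Not at hg
    convert Set.definable_empty using 1
    exact Set.eq_empty_of_forall_notMem fun x hx => hg _ hx

theorem stablyEmbeddedIn_of_forall_isInftyOrRational [Nontrivial H] (hH : IsRegularOAG H)
    (hc : ∀ c : OrderCut G, c.IsRealisedIn f → c.IsInftyOrRational) : StablyEmbeddedIn f := by
  intro m D hD
  obtain ⟨S, hS, hSU⟩ := exists_finite_of_mem_agree (eventually_mem_iff_of_definable hH hD)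
  refine definable_of_determined
    (T := (fun a => {x : Fin m → G | 0 < a.1.1 (fun i => f (x i))}) '' S ∪
      (fun a => {x : Fin m → G | a.1.1 (fun i => f (x i)) ∈ multiples H a.2}) '' S)
    ((hS.image _).union (hS.image _)) ?_ fun x x' h => ?_
  · rintro _ (⟨a, _, rfl⟩ | ⟨a, _, rfl⟩)
    · exact definable_trace_pos f hc a.1.2
    · exact definable_trace_mem_multiples f a.1.2 a.2
  · exact hSU (fun i => f (x i), fun i => f (x' i)) fun a ha =>
      ⟨h _ (Or.inl ⟨a, ha, rfl⟩), h _ (Or.inr ⟨a, ha, rfl⟩)⟩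

omit [IsOrderedAddMonoid G] [IsOrderedAddMonoid H] in
theorem isDefinable_of_isRealisedIn {f : G ↪ₑ[Language.oag] H} (hf : StablyEmbeddedIn f)
    {c : OrderCut G} (hc : c.IsRealisedIn f) : c.IsDefinable := by
  obtain ⟨a, hl, hr⟩ := hc
  exact isDefinable_of_stablyEmbeddedIn hf a (fun l h => hl l h)
    fun r h hlt => lt_asymm (hr r h) hlt

end Stable

/-! ### Elementary extensions of ordered abelian groups -/

section Extensions

variable {G : Type*} [AddCommGroup G] [LinearOrder G] [IsOrderedAddMonoid G]

/-- Converse of `exists_zsmul_mem_Ico`, so that regularity is a first-order property. -/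
theorem isRegularOAG_of_exists_zsmul_mem_Ico
    (h : ∀ n : ℕ, 0 < n → ∀ e : G, 0 < e → ∀ a : G, ∃ y : G, a ≤ n • y ∧ n • y < a + n • e) :
    IsRegularOAG G := by
  intro C hC hne n hn x
  obtain ⟨a, rfl⟩ := QuotientAddGroup.mk_surjective x
  obtain ⟨⟨e, he⟩, he0⟩ := AddSubgroup.ne_bot_iff_exists_ne_zero.1 hne
  replace he0 : e ≠ 0 := fun h => he0 (Subtype.ext h)
  have habs : |e| ∈ C := by
    rcases abs_choice e with h | h <;> rw [h]
    exacts [he, neg_mem he]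
  obtain ⟨y, hy₁, hy₂⟩ := h n hn |e| (abs_pos.2 he0) a
  refine ⟨(y : G ⧸ C), Eq.symm (QuotientAddGroup.eq.2 ?_)⟩
  rw [neg_add_eq_sub]
  exact hC.out C.zero_mem (C.nsmul_mem habs n) ⟨sub_nonneg.2 hy₁, (sub_lt_iff_lt_add'.2 hy₂).le⟩

/-- Universal sentences pass to elementary extensions. -/
theorem forall_realize_of_elementary {L : Language} {M N : Type*} [L.Structure M] [L.Structure N]
    (f : M ↪ₑ[L] N) {n : ℕ} (φ : L.BoundedFormula Empty n)
    (h : ∀ xs : Fin n → M, φ.Realize default xs) (xs : Fin n → N) : φ.Realize default xs :=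
  Language.BoundedFormula.realize_alls.1
    ((f.map_sentence φ.alls).1 (Language.BoundedFormula.realize_alls.2 h)) xs

theorem isRegularOAG_of_elementary (hG : IsRegularOAG G) {H : Type*} [AddCommGroup H]
    [LinearOrder H] [IsOrderedAddMonoid H] (f : G ↪ₑ[Language.oag] H) : IsRegularOAG H := by
  refine isRegularOAG_of_exists_zsmul_mem_Ico fun n hn e he a => ?_
  -- `0 < x₀ → ∃ x₂, ¬ n x₂ < x₁ ∧ n x₂ < x₁ + n x₀`
  let x : Fin 3 → Language.oag.Term (Empty ⊕ Fin 3) := fun i => .var (Sum.inr i)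
  let φ : Language.oag.BoundedFormula Empty 2 :=
    (ltSymb.boundedFormula₂ (.func zeroSymb ![]) (.var (Sum.inr 0))).imp
      ((ltSymb.boundedFormula₂ (nsmulTerm (x 2) n) (x 1)).not ⊓
        ltSymb.boundedFormula₂ (nsmulTerm (x 2) n)
          (.func addSymb ![x 1, nsmulTerm (x 0) n])).ex
  have h := forall_realize_of_elementary f φ (fun xs => by
    intro h0
    obtain ⟨y, hy₁, hy₂⟩ := exists_zsmul_mem_Ico hG hn (e := xs 0) h0 (xs 1)
    rw [natCast_zsmul] at hy₁ hy₂
    refine Language.BoundedFormula.realize_ex.2 ⟨y, Language.BoundedFormula.realize_inf.2 ⟨?_, ?_⟩⟩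
    · rw [Language.BoundedFormula.realize_not, Language.BoundedFormula.realize_rel₂,
        realize_nsmulTerm]
      exact not_lt.2 hy₁
    · rw [Language.BoundedFormula.realize_rel₂, realize_nsmulTerm, Language.Term.realize_func]
      change n • y < xs 1 + (nsmulTerm (x 0) n).realize _
      rw [realize_nsmulTerm]
      rw [natCast_zsmul] at hy₂
      exact hy₂) ![e, a]
  have he' : (ltSymb.boundedFormula₂ (.func zeroSymb ![]) (.var (Sum.inr 0)) :
      Language.oag.BoundedFormula Empty 2).Realize default ![e, a] := he
  obtain ⟨y, hy⟩ := Language.BoundedFormula.realize_ex.1 (h he')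
  obtain ⟨hy₁, hy₂⟩ := Language.BoundedFormula.realize_inf.1 hy
  rw [Language.BoundedFormula.realize_not, Language.BoundedFormula.realize_rel₂,
    realize_nsmulTerm] at hy₁
  rw [Language.BoundedFormula.realize_rel₂, realize_nsmulTerm, Language.Term.realize_func] at hy₂
  change n • y < a + (nsmulTerm (x 0) n).realize _ at hy₂
  rw [realize_nsmulTerm] at hy₂
  exact ⟨y, not_lt.1 hy₁, hy₂⟩

/-- Every elementary extension of an ordered abelian group, a priori only a structure, is the
structure of an ordered abelian group. -/
theorem exists_orderedAddCommGroup {N : Type*} [S : Language.oag.Structure N]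
    (f : G ↪ₑ[Language.oag] N) :
    ∃ (_ : AddCommGroup N) (_ : LinearOrder N), IsOrderedAddMonoid N ∧
      S = Language.oag.instStructure N := by
  let add : N → N → N := fun a b => Language.Structure.funMap addSymb ![a, b]
  let neg : N → N := fun a => Language.Structure.funMap negSymb ![a]
  let zero : N := Language.Structure.funMap zeroSymb ![]
  let lt : N → N → Prop := fun a b => Language.Structure.RelMap ltSymb ![a, b]
  let x (n : ℕ) (i : Fin n) : Language.oag.Term (Empty ⊕ Fin n) := .var (Sum.inr i)
  let tadd {α : Type} (s t : Language.oag.Term α) : Language.oag.Term α := .func addSymb ![s, t]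
  have vec2 : ∀ v : Fin 2 → N, v = ![v 0, v 1] := fun v =>
    funext fun i => by fin_cases i <;> rfl
  have vec1 : ∀ v : Fin 1 → N, v = ![v 0] := fun v =>
    funext fun i => by fin_cases i; rfl
  have vec0 : ∀ v : Fin 0 → N, v = ![] := fun v => Subsingleton.elim _ _
  have radd : ∀ {α : Type} (s t : Language.oag.Term α) (v : α → N),
      (tadd s t).realize v = add (s.realize v) (t.realize v) := fun s t v =>
    congrArg _ (vec2 _)
  have rneg : ∀ {α : Type} (s : Language.oag.Term α) (v : α → N),
      (Language.Term.func negSymb ![s]).realize v = neg (s.realize v) := fun s v =>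
    congrArg _ (vec1 _)
  have rzero : ∀ {α : Type} (v : α → N),
      (Language.Term.func zeroSymb ![]).realize v = zero := fun v => congrArg _ (vec0 _)
  have rlt : ∀ {n : ℕ} (s t : Language.oag.Term (Empty ⊕ Fin n)) (xs : Fin n → N),
      (ltSymb.boundedFormula₂ s t).Realize default xs ↔
        lt (s.realize (Sum.elim default xs)) (t.realize (Sum.elim default xs)) := fun s t xs =>
    Language.BoundedFormula.realize_rel₂
  have hassoc : ∀ a b c, add (add a b) c = add a (add b c) := fun a b c => by
    have h := forall_realize_of_elementary f
      ((tadd (tadd (x 3 0) (x 3 1)) (x 3 2)).bdEqual (tadd (x 3 0) (tadd (x 3 1) (x 3 2))))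
      (fun xs => add_assoc (xs 0) (xs 1) (xs 2)) ![a, b, c]
    rwa [Language.BoundedFormula.realize_bdEqual, radd, radd, radd, radd] at h
  have hcomm : ∀ a b, add a b = add b a := fun a b => by
    have h := forall_realize_of_elementary f
      ((tadd (x 2 0) (x 2 1)).bdEqual (tadd (x 2 1) (x 2 0)))
      (fun xs => add_comm (xs 0) (xs 1)) ![a, b]
    rwa [Language.BoundedFormula.realize_bdEqual, radd, radd] at h
  have hzero : ∀ a, add zero a = a := fun a => by
    have h := forall_realize_of_elementary f
      ((tadd (.func zeroSymb ![]) (x 1 0)).bdEqual (x 1 0))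
      (fun xs => zero_add (xs 0)) ![a]
    rwa [Language.BoundedFormula.realize_bdEqual, radd, rzero] at h
  have hneg : ∀ a, add (neg a) a = zero := fun a => by
    have h := forall_realize_of_elementary f
      ((tadd (.func negSymb ![x 1 0]) (x 1 0)).bdEqual (.func zeroSymb ![]))
      (fun xs => neg_add_cancel (xs 0)) ![a]
    rwa [Language.BoundedFormula.realize_bdEqual, radd, rneg, rzero] at h
  have hirrefl : ∀ a, ¬ lt a a := fun a => by
    have h := forall_realize_of_elementary f
      (ltSymb.boundedFormula₂ (x 1 0) (x 1 0)).not
      (fun xs => lt_irrefl (xs 0)) ![a]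
    rwa [Language.BoundedFormula.realize_not, rlt] at h
  have htrans : ∀ a b c, lt a b → lt b c → lt a c := fun a b c => by
    have h := forall_realize_of_elementary f
      ((ltSymb.boundedFormula₂ (x 3 0) (x 3 1)).imp
        ((ltSymb.boundedFormula₂ (x 3 1) (x 3 2)).imp (ltSymb.boundedFormula₂ (x 3 0) (x 3 2))))
      (fun xs h₁ h₂ => lt_trans (a := xs 0) (b := xs 1) (c := xs 2) h₁ h₂) ![a, b, c]
    rwa [Language.BoundedFormula.realize_imp, Language.BoundedFormula.realize_imp, rlt, rlt,
      rlt] at h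
  have htri : ∀ a b, ¬ lt a b → ¬ lt b a → a = b := fun a b => by
    have h := forall_realize_of_elementary f
      ((ltSymb.boundedFormula₂ (x 2 0) (x 2 1)).not.imp
        ((ltSymb.boundedFormula₂ (x 2 1) (x 2 0)).not.imp ((x 2 0).bdEqual (x 2 1))))
      (fun xs h₁ h₂ => le_antisymm (a := xs 0) (b := xs 1) (not_lt.1 h₂) (not_lt.1 h₁)) ![a, b]
    rwa [Language.BoundedFormula.realize_imp, Language.BoundedFormula.realize_imp,
      Language.BoundedFormula.realize_not, Language.BoundedFormula.realize_not, rlt, rlt,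
      Language.BoundedFormula.realize_bdEqual] at h
  have hmono : ∀ a b c, lt a b → lt (add c a) (add c b) := fun a b c => by
    have h := forall_realize_of_elementary f
      ((ltSymb.boundedFormula₂ (x 3 0) (x 3 1)).imp
        (ltSymb.boundedFormula₂ (tadd (x 3 2) (x 3 0)) (tadd (x 3 2) (x 3 1))))
      (fun xs h => add_lt_add_right (b := xs 0) (c := xs 1) h (xs 2)) ![a, b, c]
    rwa [Language.BoundedFormula.realize_imp, rlt, rlt, radd, radd] at h
  have hsto : IsStrictTotalOrder N lt :=
    { irrefl := hirrefl
      trans := htrans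
      trichotomous := htri }
  let _ : Add N := ⟨add⟩
  let _ : Neg N := ⟨neg⟩
  let _ : Zero N := ⟨zero⟩
  let grp : AddCommGroup N :=
    { AddGroup.ofLeftAxioms hassoc hzero hneg with add_comm := hcomm }
  classical
  let ord : LinearOrder N := linearOrderOfSTO lt
  refine ⟨grp, ord, { add_le_add_left := fun a b hab c => ?_ }, ?_⟩
  · rcases hab.eq_or_lt with rfl | hlt
    · exact le_rfl
    · rw [add_comm a, add_comm b]
      exact le_of_lt (hmono a b c hlt)
  · refine Language.Structure.ext ?_ ?_
    · funext n F v
      cases F with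
      | zero => exact congrArg _ (vec0 v)
      | neg => exact congrArg _ (vec1 v)
      | add => exact congrArg _ (vec2 v)
    · funext n R v
      cases R
      exact congrArg _ (vec2 v)

end Extensions

/-! ### Realising cuts -/

section Ultrapower

/-- The diagonal embedding of a structure into its ultrapower. -/
def diagonal {L : Language} {M : Type*} [L.Structure M] [Nonempty M] {α : Type*}
    (u : Ultrafilter α) : M ↪ₑ[L] (u : Filter α).Product fun _ => M where
  toFun m := ((fun _ => m : α → M) : (u : Filter α).Product fun _ => M)
  map_formula' := fun n φ x => by
    have h := Language.Ultraproduct.realize_formula_cast (u := u) φ fun i (_ : α) => x i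
    rw [eventually_const] at h
    exact h

variable {G : Type*} [AddCommGroup G] [LinearOrder G] [IsOrderedAddMonoid G]

omit [IsOrderedAddMonoid G] in
theorem relMap_ltSymb_product {α : Type*} (u : Ultrafilter α) (x y : α → G) :
    Language.Structure.RelMap ltSymb
        ![(x : (u : Filter α).Product fun _ => G), (y : (u : Filter α).Product fun _ => G)] ↔
      ∀ᶠ s in (u : Filter α), x s < y s := by
  have h := Language.Ultraproduct.realize_formula_cast (u := u)
    (ltSymb.formula₂ (.var 0) (.var 1) : Language.oag.Formula (Fin 2)) ![x, y]
  simp only [Language.Formula.realize_rel₂, Language.Term.realize_var] at h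
  exact h

/-- A cut that is not rational is realised in an ultrapower, by the class of a function choosing,
for each finite set, an element of the left side above all elements of the left side in it. -/
theorem isInftyOrRational_of_stablyEmbedded [Nontrivial G] (hG : IsRegularOAG G)
    (h : StablyEmbedded Language.oag G) (c : OrderCut G) : c.IsInftyOrRational := by
  by_contra hc
  have hmax : ∀ l ∈ c.left, ∃ l' ∈ c.left, l < l' := fun l hl => by
    by_contra! hne
    exact hc (isInftyOrRational_of_isGreatest ⟨hl, hne⟩)
  have hL : c.left.Nonempty := Set.nonempty_iff_ne_empty.2 fun h => hc (Or.inl h)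
  have hex : ∀ s : Finset G, ∃ a ∈ c.left, ∀ l ∈ s, l ∈ c.left → l < a := by
    classical
    intro s
    induction s using Finset.induction_on with
    | empty =>
      obtain ⟨a, ha⟩ := hL
      exact ⟨a, ha, by simp⟩
    | insert b s _ ih =>
      obtain ⟨a, ha, has⟩ := ih
      by_cases hb : b ∈ c.left
      · obtain ⟨a', ha', hlt⟩ := hmax (max a b) (by
          rcases max_choice a b with e | e <;> rw [e] <;> assumption)
        refine ⟨a', ha', Finset.forall_mem_insert _ _ _ |>.2
          ⟨fun _ => (le_max_right _ _).trans_lt hlt, fun l hl hlL => ?_⟩⟩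
        exact (has l hl hlL).trans ((le_max_left _ _).trans_lt hlt)
      · exact ⟨a, ha, Finset.forall_mem_insert _ _ _ |>.2 ⟨fun h => absurd h hb, has⟩⟩
  choose a haL ha using hex
  let u : Ultrafilter (Finset G) := Ultrafilter.of atTop
  refine hc (isInftyOrRational_of_isDefinable hG (isDefinable_of_stablyEmbeddedIn
    (h _ (diagonal u)) (a : (u : Filter (Finset G)).Product fun _ => G)
    (fun l hl => ?_) fun r hr hlt => ?_))
  · refine (relMap_ltSymb_product u (fun _ => l) a).2 ?_
    have : ∀ᶠ s : Finset G in atTop, {l} ≤ s := eventually_ge_atTop _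
    filter_upwards [Ultrafilter.of_le _ this] with s hs
    exact ha s l (hs (Finset.mem_singleton_self l)) hl
  · obtain ⟨s, hs⟩ := ((relMap_ltSymb_product u (fun _ => r) a).1 hlt).exists
    exact lt_asymm hs (c.lt _ (haL s) r hr)

end Ultrapower

/-! ### Groups all of whose cuts are rational -/

section AllCuts

variable {G : Type*} [AddCommGroup G] [LinearOrder G] [IsOrderedAddMonoid G]

/-- If `y > 0` and the multiples of `y` are bounded, the cut above them is not of the form
`(g / n)⁺` or `(g / n)⁻`: regularity gives an element above all multiples of `y` and below
`g / n`. -/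
theorem archimedean_of_forall_isInftyOrRational (hG : IsRegularOAG G)
    (h : ∀ c : OrderCut G, c.IsInftyOrRational) : Archimedean G := by
  refine ⟨fun x y hy => ?_⟩
  by_contra! hx
  -- The cut above the convex hull of the multiples of `y`.
  let c : OrderCut G :=
    { left := {z | ∃ k : ℕ, z ≤ k • y}
      right := {z | ∀ k : ℕ, k • y < z}
      union_eq := Set.eq_univ_of_forall fun z => by
        by_cases hz : ∃ k : ℕ, z ≤ k • y
        · exact Or.inl hz
        · exact Or.inr fun k => not_le.1 fun hk => hz ⟨k, hk⟩
      lt := fun l ⟨k, hk⟩ r hr => hk.trans_lt (hr k) }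
  suffices ∀ (g : G) (n : ℕ), 0 < n → (∀ z ∈ c.left, n • z ≤ g) →
      ¬ ∀ z, n • z < g → z ∈ c.left by
    rcases h c with hb | hb | ⟨g, n, hb | hb⟩
    · exact Set.notMem_empty (0 : G) ((show c.left = ∅ from hb) ▸ ⟨0, by simp⟩)
    · exact Set.notMem_empty x ((show c.right = ∅ from hb) ▸ hx)
    · have e : ∀ z, z ∈ c.right ↔ g < (n : ℕ) • z := fun z => (Set.ext_iff.1 hb z).trans mk_lt_coe
      refine this g n n.pos (fun z hz => ?_) fun z hz => ?_
      · rw [mem_left_iff, e, not_lt] at hz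
        exact hz
      · rw [mem_left_iff, e]
        exact hz.not_gt
    · have e : ∀ z, z ∈ c.left ↔ (n : ℕ) • z < g := fun z => (Set.ext_iff.1 hb z).trans coe_lt_mk
      exact this g n n.pos (fun z hz => ((e z).1 hz).le) fun z hz => (e z).2 hz
  intro g n hn h₁ h₂
  have hg : ∀ k : ℕ, k • y < g := fun k => by
    calc k • y < (k + 1) • y := by rw [succ_nsmul]; simpa using hy
      _ ≤ n • ((k + 1) • y) := le_self_nsmul (nsmul_nonneg hy.le _) hn.ne'
      _ ≤ g := h₁ _ ⟨k + 1, le_rfl⟩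
  -- By regularity some `w` is close to `g / (2 n)`.
  obtain ⟨w, hw₁, hw₂⟩ := exists_zsmul_mem_Ico hG (n := 2 * n) (by omega) hy g
  rw [natCast_zsmul] at hw₁ hw₂
  rw [natCast_zsmul] at hw₂
  obtain ⟨k, hk⟩ := h₂ w (by
    have h3 : (2 * n) • w < g + g := hw₂.trans (by gcongr; exact hg _)
    rw [mul_nsmul', two_nsmul] at h3
    by_contra! hge
    exact absurd h3 (not_lt.2 (add_le_add hge hge)))
  have h4 : g ≤ (2 * n) • (k • y) := hw₁.trans (nsmul_le_nsmul_right hk _)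
  rw [← mul_nsmul'] at h4
  exact absurd (hg _) (not_lt.2 h4)

theorem archimedean_divisibleHull [Archimedean G] : Archimedean (DivisibleHull G) := by
  refine ⟨fun x y hy => ?_⟩
  induction x using DivisibleHull.ind with | mk g n
  induction y using DivisibleHull.ind with | mk h m
  have hh : 0 < h := by
    rw [← DivisibleHull.mk_zero 1, DivisibleHull.mk_lt_mk] at hy
    simpa using hy
  obtain ⟨k, hk⟩ := Archimedean.arch ((m : ℕ) • g) hh
  refine ⟨k, ?_⟩
  rw [DivisibleHull.nsmul_mk, DivisibleHull.mk_le_mk]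
  exact hk.trans (le_self_nsmul (nsmul_nonneg hh.le k) n.pos.ne')

/-- In a dense archimedean group all of whose cuts are rational, every real number is the image of
the point of the divisible hull defining its cut. -/
theorem nonempty_divisibleHull_iso_real [Nontrivial G] [Archimedean G] (hd : IsDenseOAG G)
    (h : ∀ c : OrderCut G, c.IsInftyOrRational) : Nonempty (DivisibleHull G ≃+o ℝ) := by
  have := archimedean_divisibleHull (G := G)
  obtain ⟨Φ, hΦ⟩ := Archimedean.exists_orderAddMonoidHom_real_injective (DivisibleHull G)
  have hmono : StrictMono Φ := Φ.monotone'.strictMono_of_injective hΦ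
  let ψ : G →+ ℝ := (Φ : DivisibleHull G →+ ℝ).comp (DivisibleHull.coeAddMonoidHom G)
  have hψ : ∀ g, ψ g = Φ g := fun g => rfl
  have hpos : ∀ g : G, 0 < g → 0 < ψ g := fun g hg => by
    rw [← map_zero ψ]
    exact hmono (coe_lt_coe_hull.2 hg)
  have hdense : ∀ a b : ℝ, a < b → ∃ g : G, a < ψ g ∧ ψ g < b := by
    have : Dense (ψ.range : Set ℝ) := by
      refine ψ.range.dense_of_not_isolated_zero fun ε hε => ?_
      obtain ⟨u, hu⟩ := exists_zero_lt (α := G)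
      obtain ⟨n, hn⟩ := exists_nat_gt (ψ u / ε)
      obtain ⟨e, he, hle⟩ := exists_nsmul_le_of_isDenseOAG hd n hu
      refine ⟨ψ e, ⟨e, rfl⟩, hpos e he, ?_⟩
      have hle' : (n : ℝ) * ψ e ≤ ψ u := by
        rw [← nsmul_eq_mul, ← map_nsmul, ← sub_nonneg, ← map_sub]
        rcases (sub_nonneg.2 hle).eq_or_lt with h0 | h0
        · rw [← h0, map_zero]
        · exact (hpos _ h0).le
      have hn' : ψ u < n * ε := (div_lt_iff₀ hε).1 hn
      exact lt_of_mul_lt_mul_left (hle'.trans_lt hn') (Nat.cast_nonneg n)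
    intro a b hab
    obtain ⟨_, ⟨g, rfl⟩, hg⟩ := this.exists_between hab
    exact ⟨g, hg⟩
  have hsurj : Function.Surjective Φ := fun r => by
    let c : OrderCut G :=
      { left := {g | ψ g < r}
        right := {g | r ≤ ψ g}
        union_eq := Set.eq_univ_of_forall fun g => lt_or_ge (ψ g) r
        lt := fun a ha b hb => coe_lt_coe_hull.1 (hmono.lt_iff_lt.1 (lt_of_lt_of_le ha hb)) }
    rcases h c with hb | hb | ⟨g, n, hb | hb⟩
    · obtain ⟨g, _, hg⟩ := hdense (r - 1) r (by linarith)
      exact absurd ((show c.left = ∅ from hb) ▸ hg : g ∈ (∅ : Set G)) (Set.notMem_empty g)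
    · obtain ⟨g, hg, _⟩ := hdense r (r + 1) (by linarith)
      exact absurd ((show c.right = ∅ from hb) ▸ hg.le : g ∈ (∅ : Set G)) (Set.notMem_empty g)
    · refine ⟨DivisibleHull.mk g n, ?_⟩
      have e : ∀ x, r ≤ ψ x ↔ Φ (DivisibleHull.mk g n) < ψ x := fun x =>
        (Set.ext_iff.1 hb x).trans hmono.lt_iff_lt.symm
      rcases lt_trichotomy (Φ (DivisibleHull.mk g n)) r with hlt | heq | hgt
      · obtain ⟨x, hx₁, hx₂⟩ := hdense _ _ hlt
        exact absurd ((e x).2 hx₁) (not_le.2 hx₂)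
      · exact heq
      · obtain ⟨x, hx₁, hx₂⟩ := hdense _ _ hgt
        exact absurd ((e x).1 hx₁.le) hx₂.not_gt
    · refine ⟨DivisibleHull.mk g n, ?_⟩
      have e : ∀ x, ψ x < r ↔ ψ x < Φ (DivisibleHull.mk g n) := fun x =>
        (Set.ext_iff.1 hb x).trans hmono.lt_iff_lt.symm
      rcases lt_trichotomy (Φ (DivisibleHull.mk g n)) r with hlt | heq | hgt
      · obtain ⟨x, hx₁, hx₂⟩ := hdense _ _ hlt
        exact absurd ((e x).1 hx₂) hx₁.not_gt
      · exact heq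
      · obtain ⟨x, hx₁, hx₂⟩ := hdense _ _ hgt
        exact absurd ((e x).2 hx₂) hx₁.not_gt
  exact ⟨{ AddEquiv.ofBijective (Φ : DivisibleHull G →+ ℝ) ⟨hΦ, hsurj⟩ with
    map_le_map_iff' := hmono.le_iff_le }⟩

/-- The supremum of the left side of a cut, transported to the divisible hull, defines the cut. -/
theorem isInftyOrRational_of_iso_real (e : DivisibleHull G ≃+o ℝ) (c : OrderCut G) :
    c.IsInftyOrRational := by
  have hlt : ∀ x y : DivisibleHull G, e x < e y ↔ x < y := fun x y => map_lt_map_iff e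
  rcases c.left.eq_empty_or_nonempty with hL | hL
  · exact Or.inl hL
  rcases c.right.eq_empty_or_nonempty with hR | hR
  · exact Or.inr (Or.inl hR)
  let A : Set ℝ := (fun x : G => e x) '' c.left
  obtain ⟨r₀, hr₀⟩ := hR
  have hub : ∀ r ∈ c.right, e r ∈ upperBounds A := by
    rintro r hr _ ⟨l, hl, rfl⟩
    exact ((hlt _ _).2 (coe_lt_coe_hull.2 (c.lt l hl r hr))).le
  have hlub : IsLUB A (sSup A) := isLUB_csSup (hL.image _) ⟨_, hub r₀ hr₀⟩
  obtain ⟨q, hq⟩ : ∃ q, e q = sSup A := ⟨e.symm (sSup A), e.apply_symm_apply _⟩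
  have hl : ∀ x ∈ c.left, ¬ q < (x : DivisibleHull G) := fun x hx h => by
    rw [← hlt, hq] at h
    exact absurd (hlub.1 ⟨x, hx, rfl⟩) (not_le.2 h)
  have hr : ∀ x ∈ c.right, ¬ (x : DivisibleHull G) < q := fun x hx h => by
    rw [← hlt, hq] at h
    exact absurd (hlub.2 (hub x hx)) (not_le.2 h)
  clear hlub hq
  induction q using DivisibleHull.ind with | mk g n
  by_cases hx : ∃ x ∈ c.left, (x : DivisibleHull G) = DivisibleHull.mk g n
  · obtain ⟨x, hx, hxq⟩ := hx
    refine Or.inr (Or.inr ⟨g, n, Or.inl (Set.ext fun y => ⟨fun hy => ?_, fun hy => ?_⟩)⟩)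
    · exact hxq ▸ coe_lt_coe_hull.2 (c.lt x hx y hy)
    · exact (mem_right_iff c).2 fun hy' => hl y hy' hy
  · push Not at hx
    refine Or.inr (Or.inr ⟨g, n, Or.inr (Set.ext fun y => ⟨fun hy => ?_, fun hy => ?_⟩)⟩)
    · exact (not_lt.1 (hl y hy)).lt_of_ne (hx y hy)
    · exact (mem_left_iff c).2 fun hy' => hr y hy' hy

theorem isInftyOrRational_of_iso_int (e : G ≃+o ℤ) (c : OrderCut G) : c.IsInftyOrRational := by
  rcases c.left.eq_empty_or_nonempty with hL | ⟨l, hl⟩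
  · exact Or.inl hL
  rcases c.right.eq_empty_or_nonempty with hR | ⟨r, hr⟩
  · exact Or.inr (Or.inl hR)
  have hle : ∀ x y, e x ≤ e y ↔ x ≤ y := fun x y => map_le_map_iff e
  obtain ⟨m, hm, hmax⟩ := Int.exists_greatest_of_bdd (P := fun z => e.symm z ∈ c.left)
    ⟨e r, fun z hz => by
      have := (hle _ _).2 (c.lt _ hz r hr).le
      rwa [e.apply_symm_apply] at this⟩ ⟨e l, by rwa [e.symm_apply_apply]⟩
  refine isInftyOrRational_of_isGreatest (l := e.symm m) ⟨hm, fun x hx => ?_⟩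
  rw [← hle, e.apply_symm_apply]
  exact hmax _ (by rwa [e.symm_apply_apply])

theorem forall_isInftyOrRational_iff [Nontrivial G] (hG : IsRegularOAG G) :
    (∀ c : OrderCut G, c.IsInftyOrRational) ↔
      (IsDenseOAG G ∧ Archimedean G ∧ Nonempty (DivisibleHull G ≃+o ℝ)) ∨
        Nonempty (G ≃+o ℤ) := by
  refine ⟨fun h => ?_, ?_⟩
  · have := archimedean_of_forall_isInftyOrRational hG h
    by_cases hd : IsDiscreteOAG G
    · obtain ⟨a, ha⟩ := hd
      exact Or.inr ⟨LinearOrderedAddCommGroup.int_orderAddMonoidIso_of_isLeast_pos ha⟩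
    · exact Or.inl ⟨hd, this, nonempty_divisibleHull_iso_real hd h⟩
  · rintro (⟨_, _, ⟨e⟩⟩ | ⟨⟨e⟩⟩)
    · exact isInftyOrRational_of_iso_real e
    · exact isInftyOrRational_of_iso_int e

end AllCuts

theorem stablyEmbedded_of_forall_isInftyOrRational {G : Type*} [AddCommGroup G] [LinearOrder G]
    [IsOrderedAddMonoid G] [Nontrivial G] (hG : IsRegularOAG G)
    (h : ∀ c : OrderCut G, c.IsInftyOrRational) : StablyEmbedded Language.oag G := by
  intro N S f
  obtain ⟨_, _, _, rfl⟩ := exists_orderedAddCommGroup f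
  have : Nontrivial N := f.injective.nontrivial
  exact stablyEmbeddedIn_of_forall_isInftyOrRational f (isRegularOAG_of_elementary hG f)
    fun c _ => h c

end RegularOAG

theorem mainTheorem9 (G : Type*) [AddCommGroup G] [LinearOrder G] [IsOrderedAddMonoid G]
    [Nontrivial G] (hG : IsRegularOAG G) :
    -- the definable cuts of `G`
    (∀ c : OrderCut G, c.IsDefinable ↔ c.IsInftyOrRational) ∧
    -- elementary pairs
    (∀ (H : Type*) [AddCommGroup H] [LinearOrder H] [IsOrderedAddMonoid H],
      IsRegularOAG H → ∀ f : FirstOrder.Language.oag.ElementaryEmbedding G H,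
        (FirstOrder.StablyEmbeddedIn f ↔
          ∀ c : OrderCut G, c.IsRealisedIn f → c.IsDefinable) ∧
        (FirstOrder.StablyEmbeddedIn f ↔
          ∀ c : OrderCut G, c.IsRealisedIn f → c.IsInftyOrRational)) ∧
    -- the absolute version
    List.TFAE [
      FirstOrder.StablyEmbedded FirstOrder.Language.oag G,
      ∀ c : OrderCut G, c.IsDefinable,
      (IsDenseOAG G ∧ Archimedean G ∧ Nonempty (DivisibleHull G ≃+o ℝ)) ∨
        Nonempty (G ≃+o ℤ)] := by
  have ha : ∀ c : OrderCut G, c.IsDefinable ↔ c.IsInftyOrRational :=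
    RegularOAG.isDefinable_iff_isInftyOrRational hG
  refine ⟨ha, fun H _ _ _ hH f => ?_, ?_⟩
  · have : Nontrivial H := f.injective.nontrivial
    have hb : FirstOrder.StablyEmbeddedIn f ↔
        ∀ c : OrderCut G, c.IsRealisedIn f → c.IsInftyOrRational :=
      ⟨fun h c hc => (ha c).1 (RegularOAG.isDefinable_of_isRealisedIn h hc),
        RegularOAG.stablyEmbeddedIn_of_forall_isInftyOrRational f hH⟩
    simp only [ha]
    exact ⟨hb, hb⟩
  · rw [← RegularOAG.forall_isInftyOrRational_iff hG]
    simp only [ha]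
    tfae_have 1 → 2 := RegularOAG.isInftyOrRational_of_stablyEmbedded hG
    tfae_have 2 → 1 := RegularOAG.stablyEmbedded_of_forall_isInftyOrRational hG
    tfae_have 2 ↔ 3 := Iff.rfl
    tfae_finish
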